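/- Fix integers $e,\ell\ge 2$. An $\ell$-abacus is a set $\mathcal A\subset\mathbb Z\times\{1,\dots,\ell\}$ of beads $(\beta,j)$ (column $\beta$, row $j$) that contains all positions with $\beta\ll 0$ and none with $\beta\gg 0$. A charged $\ell$-partition $|\lambda,\mathbf s\rangle$ with $\mathbf s\in\mathbb Z^\ell$ is identified with the abacus $\{(\lambda^j_k+s_j-k+1,\,j) : 1\le j\le\ell,\ k\ge 1\}$. Order beads by $(\beta,j)<(\beta',j')$ iff $\beta<\beta'$, or $\beta=\beta'$ and $j>j'$. *Periods.* A quasiperiod of $\mathcal A$ is a sequence of $e$ beads $b_i=(\beta_i,j_i)$ of $\mathcal A$ with $\beta_{i+1}=\beta_i-1$ and $j_{i+1}\le j_i$; quasiperiods are ordered lexicographically. The first fore period $P_1$ is the largest quasiperiod; the $k$-th fore period $P_k$ is the largest quasiperiod that is smaller than $P_{k-1}$ and disjoint from $P_1,\dots,P_{k-1}$. A bead in no fore period is free. Write $b_k^{(i)}$ for the $i$-th bead of $P_k$. The $k$-th vessel $V_k$ consists of $P_k$ and of the free beads $(\beta,j)$ with $\beta(b_{k+1}^{(e)})\le\beta\le\beta(b_k^{(1)})$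 such that (a) $j>j(b_k^{(i)})$ if $\beta=\beta(b_k^{(i)})$ for some $i$; (b) $j<j(b_{k+1}^{(i)})$ if $\beta=\beta(b_{k+1}^{(i)})$ for some $i$; (c) if $\beta<\beta(b_k^{(e)})$, then $(\beta+1,j')\in V_k$ for some $j'$. The $k$-th aft period $Q_k$ is the smallest quasiperiod contained in $V_k$. A quasiperiod $P$ can be shifted one unit to the right (left) if for each of its beads the position directly to the right (left) belongs to $P$ or is not a bead of $\mathcal A$; shifting replaces the beads of $P$ by these positions. The aft period $Q_k$ of $\mathcal A$ *can travel upstream*, giving the abacus $\mathcal B$, if it can be shifted one unit to the left, the result is $\mathcal B$, and the left shift of $Q_k$ is the $k$-th fore period of $\mathcal B$. *The $\mathfrak{sl}_\infty$-crystal.* For a partition $\sigma$, the operator $\tilde b_\sigma$ successively, for $k=1,2,\dots$, adds the $k$-th good vertical $e$-strip $\sigma_k$ times; in the abacus, adding the $k$-th good vertical $e$-strip is shifting the current $k$-th fore period one unit to the right. A highest weight vertex is an abacus that is not of the form $\tilde b_\sigma\mathcal B$ with $\sigma\neq\emptyset$. The arrows of the $\mathfrak{sl}_\infty$-crystal are $\tilde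 b_\theta\mathcal A^\circ\to\tilde b_\rho\mathcal A^\circ$, with $\mathcal A^\circ$ a highest weight vertex and $\rho$ obtained from $\theta$ by adding one box; if the box lies in row $k$, write $\tilde b_\theta\mathcal A^\circ=\Upsilon_k^-\,\tilde b_\rho\mathcal A^\circ$, and $\Upsilon_k^-\mathcal A=0$ if there is no such arrow into $\mathcal A$. **Theorem.** Let $\mathcal A$ be an $\ell$-abacus. The connected component of $\mathcal A$ in the $\mathfrak{sl}_\infty$-crystal contains a unique highest weight vertex $\mathcal A^\circ$, and there is a unique partition $\theta$ with $\mathcal A=\tilde b_\theta\mathcal A^\circ$. For $k\ge1$ let $\alpha_k$ be the (finite) maximal number of successive times that the $k$-th aft period can travel upstream, starting from $\mathcal A$ (the $k$-th aft period being that of the current abacus at each step). Then $\alpha_k$ is also the largest $q\ge 0$ with $(\Upsilon_k^-)^q\mathcal A\neq0$. Only finitely many $\alpha_k$ are nonzero; let $r$ be the largest $k$ with $\alpha_k\neq0$ ($r=0$ if there is none) and $\delta_k=\sum_{m=k}^r\alpha_m$. Then $$\theta=(\delta_1,\delta_2,\dots,\delta_r).$$ Moreover a directed path from a highest weight vertex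 to $\mathcal A$ exists, and every such path has length $|\theta|$; that is, if $\mathcal A$ is the abacus of $|\lambda,\mathbf s\rangle$, then the depth of $\lambda$ in the $\mathfrak{sl}_\infty$-crystal is $q(\lambda)=|\theta|$. -/

import Mathlib

namespace SlInfty

/-! ### Abaci and charged multipartitions -/

/-- A position `(β, j)`: column `β`, row `j`.  Rows are indexed by `Fin ℓ`, from bottom to top. -/
abbrev Pos (ℓ : ℕ) : Type := ℤ × Fin ℓ

/-- An `ℓ`-abacus: a set of beads, full far to the left and empty far to the right. -/
@[ext]
structure Abacus (ℓ : ℕ) where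
  beads : Set (Pos ℓ)
  full_left : ∃ m : ℤ, ∀ β : ℤ, β ≤ m → ∀ j : Fin ℓ, (β, j) ∈ beads
  empty_right : ∃ m : ℤ, ∀ β : ℤ, m ≤ β → ∀ j : Fin ℓ, (β, j) ∉ beads

/-- The abacus of the charged `ℓ`-partition `|lam, s⟩`.  The bead of row `j` belonging to the part
number `k` (counted from `0`) of `lam j` is in column `s j - k + (lam j)_k`. -/
def abacusOf {ℓ : ℕ} (s : Fin ℓ → ℤ) (lam : Fin ℓ → YoungDiagram) : Abacus ℓ where
  beads := {b | ∃ k : ℕ, b.1 = ((lam b.2).rowLen k : ℤ) + s b.2 - k}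
  full_left := by
    refine ⟨-∑ j, (|s j| + ((lam j).colLen 0 : ℤ)), fun β hβ j => ?_⟩
    have h1 : |s j| + ((lam j).colLen 0 : ℤ) ≤ ∑ i, (|s i| + ((lam i).colLen 0 : ℤ)) :=
      Finset.single_le_sum (f := fun i => |s i| + ((lam i).colLen 0 : ℤ))
        (fun i _ => by positivity) (Finset.mem_univ j)
    have h2 := neg_abs_le (s j)
    refine ⟨(s j - β).toNat, ?_⟩
    have h3 : (lam j).rowLen (s j - β).toNat = 0 := by
      by_contra h
      have hm : ((s j - β).toNat, 0) ∈ lam j :=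
        YoungDiagram.mem_iff_lt_rowLen.2 (Nat.pos_of_ne_zero h)
      have := YoungDiagram.mem_iff_lt_colLen.1 hm
      omega
    simp only [h3]
    omega
  empty_right := by
    refine ⟨1 + ∑ j, (|s j| + ((lam j).rowLen 0 : ℤ)), fun β hβ j => ?_⟩
    rintro ⟨k, hk⟩
    have h1 : |s j| + ((lam j).rowLen 0 : ℤ) ≤ ∑ i, (|s i| + ((lam i).rowLen 0 : ℤ)) :=
      Finset.single_le_sum (f := fun i => |s i| + ((lam i).rowLen 0 : ℤ))
        (fun i _ => by positivity) (Finset.mem_univ j)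
    have h2 := le_abs_self (s j)
    have h3 := (lam j).rowLen_anti 0 k (Nat.zero_le k)
    simp only at hk
    omega

/-! ### Quasiperiods, fore periods, vessels, aft periods -/

/-- The order on positions: `b < b'` iff `β < β'`, or `β = β'` and `j > j'`. -/
def posKey {ℓ : ℕ} (b : Pos ℓ) : ℤ ×ₗ (Fin ℓ)ᵒᵈ := toLex (b.1, OrderDual.toDual b.2)

/-- Sequences of `e` positions, compared lexicographically for the order on positions. -/
def tupleKey {e ℓ : ℕ} (P : Fin e → Pos ℓ) : Lex (Fin e → ℤ ×ₗ (Fin ℓ)ᵒᵈ) :=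
  toLex (fun i => posKey (P i))

/-- `P = (b_1, …, b_e)` is an `e`-quasiperiod consisting of beads of `S`. -/
def IsQuasiperiod {e ℓ : ℕ} (S : Set (Pos ℓ)) (P : Fin e → Pos ℓ) : Prop :=
  (∀ i, P i ∈ S) ∧
    ∀ i i' : Fin e, (i' : ℕ) = i + 1 → (P i').1 = (P i).1 - 1 ∧ (P i').2 ≤ (P i).2

/-- `F 0, F 1, F 2, …` is the sequence `P_1, P_2, P_3, …` of fore periods of `A`: each `F k` is the
largest quasiperiod of `A` that is smaller than the previous ones and disjoint from them. -/
def IsForeSeq {e ℓ : ℕ} (A : Abacus ℓ) (F : ℕ → Fin e → Pos ℓ) : Prop :=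
  ∀ k, IsQuasiperiod A.beads (F k) ∧
    (∀ m < k, tupleKey (F k) < tupleKey (F m) ∧ Disjoint (Set.range (F k)) (Set.range (F m))) ∧
    ∀ P : Fin e → Pos ℓ, IsQuasiperiod A.beads P →
      (∀ m < k, tupleKey P < tupleKey (F m) ∧ Disjoint (Set.range P) (Set.range (F m))) →
      tupleKey P ≤ tupleKey (F k)

/-- `P` is the fore period of `A` with index `k` (counted from `0`, so it is `P_{k+1}`). -/
def IsFore {e ℓ : ℕ} (A : Abacus ℓ) (k : ℕ) (P : Fin e → Pos ℓ) : Prop :=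
  ∃ F : ℕ → Fin e → Pos ℓ, IsForeSeq A F ∧ F k = P

/-- A free bead: a bead that belongs to no fore period. -/
def IsFree {e ℓ : ℕ} (A : Abacus ℓ) (F : ℕ → Fin e → Pos ℓ) (b : Pos ℓ) : Prop :=
  b ∈ A.beads ∧ ∀ m i, F m i ≠ b

/-- The free bead `b` lies in the columns from that of the last bead of `F (k + 1)` to that of the
first bead of `F k`; it is above `F k` where they share a column, and below `F (k + 1)` where
they share a column. -/
def IsBetween {e ℓ : ℕ} (F : ℕ → Fin e → Pos ℓ) (k : ℕ) (b : Pos ℓ) : Prop :=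
  (∃ i, (F (k + 1) i).1 ≤ b.1) ∧ (∃ i, b.1 ≤ (F k i).1) ∧
    (∀ i, (F k i).1 = b.1 → (F k i).2 < b.2) ∧
    ∀ i, (F (k + 1) i).1 = b.1 → b.2 < (F (k + 1) i).2

/-- Membership in the vessel with index `k` (counted from `0`) of `A`, whose fore periods are `F`:
the beads of `F k`, and the free beads between `F k` and `F (k + 1)` such that, if they are to the
left of the last bead of `F k`, the vessel also has a bead in the next column to the right. -/
inductive InVessel {e ℓ : ℕ} (A : Abacus ℓ) (F : ℕ → Fin e → Pos ℓ) (k : ℕ) : Pos ℓ → Prop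
  | fore (i : Fin e) : InVessel A F k (F k i)
  | beside (b : Pos ℓ) : IsFree A F b → IsBetween F k b → (∃ i, (F k i).1 ≤ b.1) →
      InVessel A F k b
  | behind (b : Pos ℓ) (j' : Fin ℓ) : IsFree A F b → IsBetween F k b → (∀ i, b.1 < (F k i).1) →
      InVessel A F k (b.1 + 1, j') → InVessel A F k b

/-- `Q` is the aft period of `A` with index `k` (counted from `0`, so it is `Q_{k+1}`): the smallest
quasiperiod contained in the vessel with index `k`. -/
def IsAft {e ℓ : ℕ} (A : Abacus ℓ) (k : ℕ) (Q : Fin e → Pos ℓ) : Prop :=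
  ∃ F : ℕ → Fin e → Pos ℓ, IsForeSeq A F ∧ IsQuasiperiod {b | InVessel A F k b} Q ∧
    ∀ P : Fin e → Pos ℓ, IsQuasiperiod {b | InVessel A F k b} P → tupleKey Q ≤ tupleKey P

/-! ### Shifting -/

/-- The position `c` columns to the right. -/
def shiftPos {ℓ : ℕ} (c : ℤ) (b : Pos ℓ) : Pos ℓ := (b.1 + c, b.2)

/-- `P` can be shifted in `A` by `c` columns (`c = 1`: to the right, `c = -1`: to the left), and `B`
is the result.  Only the extreme bead of `P` in each row has a shift outside `P`. -/
def Shifts {e ℓ : ℕ} (c : ℤ) (A : Abacus ℓ) (P : Fin e → Pos ℓ) (B : Abacus ℓ) : Prop :=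
  (∀ i, shiftPos c (P i) ∉ Set.range P → shiftPos c (P i) ∉ A.beads) ∧
    B.beads = (A.beads \ Set.range P) ∪ Set.range (fun i => shiftPos c (P i))

/-- `Steps R n a b`: one gets from `a` to `b` in exactly `n` successive steps of `R`. -/
def Steps {X : Type*} (R : X → X → Prop) : ℕ → X → X → Prop
  | 0, a, b => a = b
  | n + 1, a, b => ∃ c, R a c ∧ Steps R n c b

/-- The aft period with index `k` of `A` can travel one unit upstream, and the result is `B`: it can
be shifted one unit to the left, and its shift is the fore period with index `k` of `B`. -/
def TravelsUpstream (e : ℕ) {ℓ : ℕ} (k : ℕ) (A B : Abacus ℓ) : Prop :=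
  ∃ Q : Fin e → Pos ℓ, IsAft A k Q ∧ Shifts (-1) A Q B ∧ IsFore B k (fun i => shiftPos (-1) (Q i))

/-! ### The `sl_∞`-crystal -/

/-- `B` is obtained from `A` by shifting the fore period with index `k` one unit to the right, that
is, by adding the good vertical `e`-strip with index `k` to the multipartition. -/
def AddsGoodStrip (e : ℕ) {ℓ : ℕ} (k : ℕ) (A B : Abacus ℓ) : Prop :=
  ∃ P : Fin e → Pos ℓ, IsFore A k P ∧ Shifts 1 A P B

/-- `B = b̃_σ A`: successively for `k = 0, 1, 2, …`, the good vertical `e`-strip with index `k` is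
added `σ_k` times (parts of `σ` are counted from `0`). -/
def Heisenberg (e : ℕ) {ℓ : ℕ} (σ : YoungDiagram) (A B : Abacus ℓ) : Prop :=
  ∃ c : ℕ → Abacus ℓ, c 0 = A ∧ c (σ.colLen 0) = B ∧
    ∀ k < σ.colLen 0, Steps (AddsGoodStrip e k) (σ.rowLen k) (c k) (c (k + 1))

/-- Highest weight vertices: those that no `b̃_σ` with `σ ≠ ∅` produces. -/
def IsHighestWeight (e : ℕ) {ℓ : ℕ} (A : Abacus ℓ) : Prop :=
  ∀ (B : Abacus ℓ) (σ : YoungDiagram), Heisenberg e σ B A → σ = ⊥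

/-- The partition `ρ` is `θ` with one box added to the row with index `k`. -/
def AddsBox (k : ℕ) (θ ρ : YoungDiagram) : Prop :=
  ∀ i, ρ.rowLen i = if i = k then θ.rowLen i + 1 else θ.rowLen i

/-- The arrows of the `sl_∞`-crystal that add a box to the row with index `k`, i.e. `B = Υ_{k+1}⁺ A`,
equivalently `A = Υ_{k+1}⁻ B`: the component of a highest weight vertex `A₀` is a copy of the Young
graph, with `b̃_θ A₀` in the place of `θ`. -/
def RowArrow (e : ℕ) {ℓ : ℕ} (k : ℕ) (A B : Abacus ℓ) : Prop :=
  ∃ (A₀ : Abacus ℓ) (θ ρ : YoungDiagram), IsHighestWeight e A₀ ∧ AddsBox k θ ρ ∧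
    Heisenberg e θ A₀ A ∧ Heisenberg e ρ A₀ B

/-- The arrows of the `sl_∞`-crystal. -/
def Arrow (e : ℕ) {ℓ : ℕ} (A B : Abacus ℓ) : Prop := ∃ k, RowArrow e k A B

/-- There is a directed path of length `n` in the `sl_∞`-crystal from a highest weight vertex
to `A`. -/
def HasDepth (e : ℕ) {ℓ : ℕ} (A : Abacus ℓ) (n : ℕ) : Prop :=
  ∃ A₀ : Abacus ℓ, IsHighestWeight e A₀ ∧ Steps (Arrow e) n A₀ A

/-- The depth `q(lam)` of the charged `ℓ`-partition `|lam, s⟩` in the `sl_∞`-crystal. -/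
noncomputable def depth (e : ℕ) {ℓ : ℕ} (s : Fin ℓ → ℤ) (lam : Fin ℓ → YoungDiagram) : ℕ :=
  sInf {n | HasDepth e (abacusOf s lam) n}

end SlInfty

open SlInfty

/-! A quasiperiod is a nondecreasing function from columns to rows, extended by `-1` on its left and
by `ℓ` on its right (`Profile`). Under the pointwise order these functions form a lattice, and
infima and suprema of quasiperiods use only beads of the given ones. The lexicographic order refines
the reversed pointwise order. Hence the greedy lexicographic choices of fore and aft periods are
pointwise extrema: `p k` is the least profile made of free beads and its own beads, and the aft
period is the greatest such profile lying before `p (k + 1)`.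

The geometric core is `Fore.shiftRight` and `Fore.shiftLeft`. No bead lies strictly between a
movable period and its shift, so every other quasiperiod stays on one side of this wall. Moving a
fore period right therefore makes it the aft period with the same index, moving an aft period left
makes it the fore period with that index, and all other fore periods stay put. Upstream travel thus
inverts the addition of a good strip. By `loose_iff`, it is possible for index `k` exactly when `p
k` lies before the right shift of `p (k + 1)`, a condition on two consecutive fore periods only.

The rest is formal. Let `gap k` be the number of successive upstream travels with index `k`.
Commutation of shifts gives `TravelsUpstream.gap_add`: a travel with index `k` lowers `gap k` by
one, raises `gap (k - 1)` by one and fixes the other gaps. Travels are confluent and lower the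
weight `∑ (k + 1) * gap k` by one, so each abacus lies over a unique packed one and is determined by
it together with the gaps. Applying `b̃_σ` adds `σ_k - σ_(k+1)` to `gap k`. So packed means highest
weight, the gaps of `b̃_θ A₀` are the differences of consecutive parts of `θ`, the arrows of the
crystal are the reversed travels, and the weight is `|θ|`. -/

namespace SlInfty

/-- The row profile of a quasiperiod: in the columns `s, …, s + e - 1` the value is the row of the
bead, to the left it is `-1` and to the right it is `ℓ`. -/
structure Profile (e ℓ : ℕ) where
  f : ℤ → ℤ
  s : ℤ
  mono : ∀ c, f c ≤ f (c + 1)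
  left : ∀ c, c < s → f c = -1
  mid : ∀ c, s ≤ c → c < s + e → 0 ≤ f c ∧ f c < ℓ
  right : ∀ c, s + e ≤ c → f c = ℓ

/-! ### The lattice of profiles, shifts and walls -/

namespace Profile

variable {e ℓ : ℕ}

theorem cases (p : Profile e ℓ) (c : ℤ) :
    (c < p.s ∧ p.f c = -1) ∨ (p.s ≤ c ∧ c < p.s + e ∧ 0 ≤ p.f c ∧ p.f c < ℓ) ∨
      (p.s + e ≤ c ∧ p.f c = ℓ) := by
  rcases lt_or_ge c p.s with h | h
  · exact Or.inl ⟨h, p.left c h⟩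
  rcases lt_or_ge c (p.s + e) with h' | h'
  · exact Or.inr (Or.inl ⟨h, h', p.mid c h h'⟩)
  · exact Or.inr (Or.inr ⟨h', p.right c h'⟩)

theorem mono' (p : Profile e ℓ) (c : ℤ) : p.f (c - 1) ≤ p.f c := by
  have := p.mono (c - 1)
  rwa [sub_add_cancel] at this

/-- Pointwise order; the largest quasiperiods have the smallest profiles. -/
instance : LE (Profile e ℓ) := ⟨fun p r => ∀ c, p.f c ≤ r.f c⟩

theorem le_refl (p : Profile e ℓ) : p ≤ p := fun _ => _root_.le_refl _

theorem le_trans {p q r : Profile e ℓ} (h : p ≤ q) (h' : q ≤ r) : p ≤ r :=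
  fun c => (h c).trans (h' c)

theorem s_anti (he : 0 < e) {p r : Profile e ℓ} (h : p ≤ r) : r.s ≤ p.s := by
  by_contra hlt
  have h1 := h p.s
  have h2 := p.cases p.s
  have h3 := r.cases p.s
  omega

@[ext]
theorem ext' (he : 0 < e) {p r : Profile e ℓ} (h : ∀ c, p.f c = r.f c) : p = r := by
  have h1 := s_anti he (p := p) (r := r) (fun c => (h c).le)
  have h2 := s_anti he (p := r) (r := p) (fun c => (h c).ge)
  cases p
  cases r
  simp only [mk.injEq]
  exact ⟨funext h, by simp only at h1 h2; omega⟩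

theorem le_antisymm (he : 0 < e) {p r : Profile e ℓ} (h : p ≤ r) (h' : r ≤ p) : p = r :=
  ext' he fun c => _root_.le_antisymm (h c) (h' c)

/-- The beads of `p` satisfy `S`. -/
def On (p : Profile e ℓ) (S : ℤ → ℤ → Prop) : Prop :=
  ∀ c, 0 ≤ p.f c → p.f c < ℓ → S c (p.f c)

theorem On.mono {p : Profile e ℓ} {S S' : ℤ → ℤ → Prop} (h : p.On S)
    (hS : ∀ c v, p.f c = v → 0 ≤ v → v < ℓ → S c v → S' c v) : p.On S' :=
  fun c h0 h1 => hS c _ rfl h0 h1 (h c h0 h1)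

/-- No common beads. -/
def Disj (p r : Profile e ℓ) : Prop := ∀ c, p.f c = r.f c → 0 ≤ p.f c → p.f c < ℓ → False

theorem Disj.symm {p r : Profile e ℓ} (h : p.Disj r) : r.Disj p := by
  intro c h1 h2 h3
  exact h c h1.symm (by omega) (by omega)

theorem Disj.ne_or {p r : Profile e ℓ} (h : p.Disj r) (c : ℤ) :
    p.f c ≠ r.f c ∨ p.f c < 0 ∨ ℓ ≤ p.f c := by
  by_contra hcon
  exact h c (by omega) (by omega) (by omega)

/-- `r` is behind `p`: it starts weakly to the left of `p`, and is above `p` in common columns. -/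
def Before (p r : Profile e ℓ) : Prop := p ≤ r ∧ p.Disj r

theorem Before.of_le {p' p r r' : Profile e ℓ} (h' : p' ≤ p) (h : p.Before r) (h'' : r ≤ r') :
    p'.Before r' := by
  refine ⟨le_trans h' (le_trans h.1 h''), fun c h1 h2 h3 => ?_⟩
  have := h' c
  have := h'' c
  have := h.1 c
  exact h.2 c (by omega) (by omega) (by omega)

theorem not_before_self (he : 0 < e) (p : Profile e ℓ) : ¬ p.Before p := by
  intro h
  have := p.cases p.s
  exact h.2 p.s rfl (by omega) (by omega)

def inf (p r : Profile e ℓ) : Profile e ℓ where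
  f c := min (p.f c) (r.f c)
  s := max p.s r.s
  mono c := by have := p.mono c; have := r.mono c; omega
  left c h := by have := p.cases c; have := r.cases c; omega
  mid c h h' := by have := p.cases c; have := r.cases c; omega
  right c h := by have := p.cases c; have := r.cases c; omega

def sup (p r : Profile e ℓ) : Profile e ℓ where
  f c := max (p.f c) (r.f c)
  s := min p.s r.s
  mono c := by have := p.mono c; have := r.mono c; omega
  left c h := by have := p.cases c; have := r.cases c; omega
  mid c h h' := by have := p.cases c; have := r.cases c; omega
  right c h := by have := p.cases c; have := r.cases c; omega

theorem inf_f (p r : Profile e ℓ) (c : ℤ) : (p.inf r).f c = min (p.f c) (r.f c) := rfl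

theorem sup_f (p r : Profile e ℓ) (c : ℤ) : (p.sup r).f c = max (p.f c) (r.f c) := rfl

theorem inf_le_left (p r : Profile e ℓ) : p.inf r ≤ p := fun _ => min_le_left _ _

theorem inf_le_right (p r : Profile e ℓ) : p.inf r ≤ r := fun _ => min_le_right _ _

theorem le_sup_left (p r : Profile e ℓ) : p ≤ p.sup r := fun _ => le_max_left _ _

/-- The beads of the infimum that are not beads of `p` are beads of `r` below `p`. -/
theorem On.inf {p r : Profile e ℓ} {S : ℤ → ℤ → Prop} (hp : p.On S)
    (hr : ∀ c, 0 ≤ r.f c → r.f c < ℓ → r.f c < p.f c → S c (r.f c)) : (p.inf r).On S := by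
  intro c h0 h1
  rw [inf_f] at *
  rcases le_or_gt (p.f c) (r.f c) with h | h
  · rw [min_eq_left h] at *
    exact hp c h0 h1
  · rw [min_eq_right h.le] at *
    exact hr c h0 h1 h

theorem On.sup {p r : Profile e ℓ} {S : ℤ → ℤ → Prop} (hp : p.On S) (hr : r.On S) :
    (p.sup r).On S := by
  intro c h0 h1
  rw [sup_f] at *
  rcases le_or_gt (p.f c) (r.f c) with h | h
  · rw [max_eq_right h] at *
    exact hr c h0 h1
  · rw [max_eq_left h.le] at *
    exact hp c h0 h1

/-- The shift by one column to the right. -/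
def shR (p : Profile e ℓ) : Profile e ℓ where
  f c := p.f (c - 1)
  s := p.s + 1
  mono c := by have := p.mono (c - 1); rw [sub_add_cancel] at this; simpa using this
  left c h := p.left _ (by omega)
  mid c h h' := p.mid _ (by omega) (by omega)
  right c h := p.right _ (by omega)

/-- The shift by one column to the left. -/
def shL (p : Profile e ℓ) : Profile e ℓ where
  f c := p.f (c + 1)
  s := p.s - 1
  mono c := p.mono (c + 1)
  left c h := p.left _ (by omega)
  mid c h h' := p.mid _ (by omega) (by omega)
  right c h := p.right _ (by omega)

theorem shR_f (p : Profile e ℓ) (c : ℤ) : p.shR.f c = p.f (c - 1) := rfl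

theorem shL_f (p : Profile e ℓ) (c : ℤ) : p.shL.f c = p.f (c + 1) := rfl

theorem shR_le (p : Profile e ℓ) : p.shR ≤ p := fun c => p.mono' c

theorem le_shL (p : Profile e ℓ) : p ≤ p.shL := fun c => p.mono c

theorem shR_shL (he : 0 < e) (p : Profile e ℓ) : p.shL.shR = p :=
  ext' he fun c => by rw [shR_f, shL_f, sub_add_cancel]

theorem shL_shR (he : 0 < e) (p : Profile e ℓ) : p.shR.shL = p :=
  ext' he fun c => by rw [shL_f, shR_f, add_sub_cancel_right]

/-- This turns a condition on the right shift of `p (k + 1)` into one on the left shift of the aft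
period with index `k`. -/
theorem before_shR_iff {q p : Profile e ℓ} : q.Before p.shR ↔ q.shL.Before p := by
  constructor
  · intro h
    refine ⟨fun c => ?_, fun c => ?_⟩
    · have := h.1 (c + 1)
      rwa [shR_f, add_sub_cancel_right] at this
    · have := h.2 (c + 1)
      rwa [shR_f, add_sub_cancel_right] at this
  · intro h
    refine ⟨fun c => ?_, fun c => ?_⟩
    · have := h.1 (c - 1)
      rwa [shL_f, sub_add_cancel] at this
    · have := h.2 (c - 1)
      rwa [shL_f, sub_add_cancel] at this

/-- A bead can replace the bead of `p` in its column, if it is between the bead of `p` in the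
preceding column and the one in its column. -/
theorem exists_lower (he : 0 < e) (p : Profile e ℓ) (c₀ x : ℤ) (h0 : 0 ≤ x) (h1 : x < ℓ)
    (hx : p.f (c₀ - 1) ≤ x) (hx' : x < p.f c₀) :
    ∃ r : Profile e ℓ, r.f c₀ = x ∧ ∀ c, c ≠ c₀ → r.f c = p.f c ∨ r.f c = -1 := by
  -- Here `c₀` is the column just to the right of `p`: the new bead is appended and the leftmost
  -- bead is dropped, so that the length remains `e`.
  by_cases h : p.f c₀ = ℓ
  · refine ⟨⟨fun c => if c = c₀ then x else if c < p.s + 1 then -1 else p.f c, p.s + 1,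
      ?_, ?_, ?_, ?_⟩, ?_, ?_⟩
    · intro c
      have a1 := p.cases c
      have a2 := p.cases (c + 1)
      have a3 := p.cases c₀
      have a4 := p.cases (c₀ - 1)
      have a5 := p.mono c
      split_ifs <;> first | omega | (subst c₀; rw [add_sub_cancel_right] at *; omega)
    · intro c hc
      have a3 := p.cases c₀
      split_ifs <;> omega
    · intro c hc hc'
      have a2 := p.cases c
      have a3 := p.cases c₀
      have a4 := p.cases (c₀ - 1)
      split_ifs <;> omega
    · intro c hc
      have a2 := p.cases c
      have a3 := p.cases c₀
      have a4 := p.cases (c₀ - 1)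
      split_ifs <;> omega
    · simp
    · intro c hc
      simp only [hc, if_false]
      split_ifs <;> simp
  · refine ⟨⟨fun c => if c = c₀ then x else p.f c, p.s, ?_, ?_, ?_, ?_⟩, ?_, ?_⟩
    · intro c
      have a5 := p.mono c
      split_ifs <;> first | omega | (subst c₀; rw [add_sub_cancel_right] at *; omega) |
        (subst c; omega)
    · intro c hc
      have a3 := p.cases c₀
      have a4 := p.cases c
      split_ifs <;> omega
    · intro c hc hc'
      have a2 := p.cases c
      split_ifs <;> omega
    · intro c hc
      have a2 := p.cases c
      have a3 := p.cases c₀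
      split_ifs <;> omega
    · simp
    · exact fun c hc => Or.inl (if_neg hc)

/-- Mirror image of `exists_lower`. If the bead is added on the left of `p`, the rightmost bead is
dropped; the clause `p.f (c + 1) = ℓ` records that it was the rightmost one. -/
theorem exists_raise (he : 0 < e) (p : Profile e ℓ) (c₀ x : ℤ) (h0 : 0 ≤ x) (h1 : x < ℓ)
    (hx : x ≤ p.f (c₀ + 1)) (hx' : p.f c₀ < x) :
    ∃ r : Profile e ℓ, r.f c₀ = x ∧
      ∀ c, c ≠ c₀ → r.f c = p.f c ∨ (r.f c = ℓ ∧ p.f (c + 1) = ℓ) := by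
  by_cases h : p.f c₀ = -1
  · refine ⟨⟨fun c => if c = c₀ then x else if p.s - 1 + e ≤ c then ℓ else p.f c, p.s - 1,
      ?_, ?_, ?_, ?_⟩, ?_, ?_⟩
    · intro c
      have a1 := p.cases c
      have a2 := p.cases (c + 1)
      have a3 := p.cases c₀
      have a4 := p.cases (c₀ + 1)
      have a5 := p.mono c
      split_ifs <;> first | omega | (subst c; omega)
    · intro c hc
      have a2 := p.cases c
      have a3 := p.cases c₀
      have a4 := p.cases (c₀ + 1)
      split_ifs <;> omega
    · intro c hc hc'
      have a2 := p.cases c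
      have a3 := p.cases c₀
      have a4 := p.cases (c₀ + 1)
      split_ifs <;> omega
    · intro c hc
      have a3 := p.cases c₀
      have a4 := p.cases (c₀ + 1)
      split_ifs <;> omega
    · simp
    · intro c hc
      have a4 := p.cases (c + 1)
      simp only [hc, if_false]
      split_ifs <;> omega
  · refine ⟨⟨fun c => if c = c₀ then x else p.f c, p.s, ?_, ?_, ?_, ?_⟩, ?_, ?_⟩
    · intro c
      have a5 := p.mono c
      split_ifs <;> first | omega | (subst c₀; omega)
    · intro c hc
      have a3 := p.cases c₀
      have a4 := p.cases c
      split_ifs <;> omega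
    · intro c hc hc'
      have a2 := p.cases c
      split_ifs <;> omega
    · intro c hc
      have a2 := p.cases c
      have a3 := p.cases c₀
      split_ifs <;> omega
    · simp
    · exact fun c hc => Or.inl (if_neg hc)

/-- A quasiperiod that avoids the wall between `p` and its right shift, except perhaps for `p`,
stays on one side. -/
theorem le_or_before_shR (he : 0 < e) {p r : Profile e ℓ}
    (h : ∀ c, 0 ≤ r.f c → r.f c < ℓ → p.f c ≤ r.f c ∨ r.f c < p.f (c - 1)) :
    p ≤ r ∨ r.Before p.shR := by
  -- Crossing is one-way: once `r` is weakly above `p`, monotonicity of `r` rules out the second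
  -- alternative of `h` in the next column.
  have key : ∀ c, r.s ≤ c → p.f c ≤ r.f c → ∀ n : ℕ, c + n < r.s + e → p.f (c + n) ≤ r.f (c + n) := by
    intro c hc hpr n
    induction n with
    | zero => simpa using fun _ => hpr
    | succ n ih =>
      intro hn
      push_cast at hn ⊢
      have h1 := ih (by omega)
      rw [← add_assoc]
      have h2 := r.cases (c + n + 1)
      have h3 := h (c + n + 1) (by omega) (by omega)
      rw [add_sub_cancel_right] at h3
      have h4 := r.mono (c + n)
      omega
  by_cases h0 : p.f r.s ≤ r.f r.s
  · left
    have h1 : p.f (r.s + e - 1) ≤ r.f (r.s + e - 1) := by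
      have := key r.s (by omega) h0 (e - 1) (by omega)
      rwa [Nat.cast_sub he, Nat.cast_one, ← add_sub_assoc] at this
    intro c
    have h2 := r.cases (r.s + e - 1)
    have h3 := p.cases (r.s + e - 1)
    have h4 := r.cases c
    have h5 := p.cases c
    rcases h4 with h4 | h4 | h4
    · omega
    · have := key r.s (by omega) h0 (c - r.s).toNat (by omega)
      rwa [show r.s + ((c - r.s).toNat : ℤ) = c by omega] at this
    · omega
  · right
    have h1 := h r.s (by have := r.cases r.s; omega) (by have := r.cases r.s; omega)
    have h2 := p.cases (r.s - 1)
    have h2' := r.cases r.s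
    have h3 : ∀ c, r.s ≤ c → c < r.s + e → r.f c < p.f (c - 1) := by
      intro c hc hc'
      have h4 := r.cases c
      rcases h c (by omega) (by omega) with h5 | h5
      -- A later crossing would persist to the last column of `r`, so `r` would not extend to the
      -- right of `p`. But it starts strictly to the right of the start of `p`, and both have length
      -- `e`.
      · have := key c hc h5 (r.s + e - 1 - c).toNat (by omega)
        rw [show c + ((r.s + e - 1 - c).toNat : ℤ) = r.s + e - 1 by omega] at this
        have h6 := p.cases (r.s + e - 1)
        have h7 := r.cases (r.s + e - 1)
        omega
      · exact h5
    refine ⟨fun c => ?_, fun c hc => ?_⟩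
    · rw [shR_f]
      have h4 := r.cases c
      have h5 := p.cases (c - 1)
      have h6 := h3 c
      omega
    · rw [shR_f] at hc
      have h4 := r.cases c
      have h6 := h3 c
      omega

/-- A quasiperiod that avoids the wall between `p` and its right shift, except perhaps for the
shift, stays on one side. -/
theorem before_or_le_shR (he : 0 < e) {p r : Profile e ℓ}
    (h : ∀ c, 0 ≤ r.f c → r.f c < ℓ → p.f c < r.f c ∨ r.f c ≤ p.f (c - 1)) :
    p.Before r ∨ r ≤ p.shR := by
  have key : ∀ c, r.s ≤ c → p.f c < r.f c → ∀ n : ℕ, c + n < r.s + e → p.f (c + n) < r.f (c + n) := by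
    intro c hc hpr n
    induction n with
    | zero => simpa using fun _ => hpr
    | succ n ih =>
      intro hn
      push_cast at hn ⊢
      have h1 := ih (by omega)
      rw [← add_assoc]
      have h2 := r.cases (c + n + 1)
      have h3 := h (c + n + 1) (by omega) (by omega)
      rw [add_sub_cancel_right] at h3
      have h4 := r.mono (c + n)
      omega
  by_cases h0 : p.f r.s < r.f r.s
  · left
    have h1 : ∀ c, r.s ≤ c → c < r.s + e → p.f c < r.f c := by
      intro c hc hc'
      have := key r.s (by omega) h0 (c - r.s).toNat (by omega)
      rwa [show r.s + ((c - r.s).toNat : ℤ) = c by omega] at this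
    have h1' := h1 (r.s + e - 1) (by omega) (by omega)
    have h2 := r.cases (r.s + e - 1)
    have h3 := p.cases (r.s + e - 1)
    refine ⟨fun c => ?_, fun c hc => ?_⟩
    · have h4 := r.cases c
      have h5 := p.cases c
      have h6 := h1 c
      omega
    · have h4 := r.cases c
      have h6 := h1 c
      omega
  · right
    have h1 := h r.s (by have := r.cases r.s; omega) (by have := r.cases r.s; omega)
    have h2 := p.cases (r.s - 1)
    have h2' := r.cases r.s
    intro c
    rw [shR_f]
    have h4 := r.cases c
    have h5 := p.cases (c - 1)
    rcases h4 with h4 | h4 | h4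
    · omega
    · rcases h c (by omega) (by omega) with h5 | h5
      · have := key c (by omega) h5 (r.s + e - 1 - c).toNat (by omega)
        rw [show c + ((r.s + e - 1 - c).toNat : ℤ) = r.s + e - 1 by omega] at this
        have h6 := p.cases (r.s + e - 1)
        have h7 := r.cases (r.s + e - 1)
        omega
      · exact h5
    · omega

/-! ### Extremal profiles in a family -/

theorem sum_lt_sum (he : 0 < e) {p r : Profile e ℓ} (h : p ≤ r) {a b c₀ : ℤ} (ha : a ≤ r.s)
    (hb : p.s + e ≤ b) (h0 : p.f c₀ < r.f c₀) :
    ∑ c ∈ Finset.Ico a b, p.f c < ∑ c ∈ Finset.Ico a b, r.f c := by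
  have h1 := s_anti he h
  have h2 := p.cases c₀
  have h3 := r.cases c₀
  exact Finset.sum_lt_sum (fun c _ => h c) ⟨c₀, Finset.mem_Ico.2 ⟨by omega, by omega⟩, h0⟩

theorem sum_nonneg_bound (p : Profile e ℓ) (a b : ℤ) :
    -((b - a).toNat : ℤ) ≤ ∑ c ∈ Finset.Ico a b, p.f c := by
  have := Finset.card_nsmul_le_sum (Finset.Ico a b) p.f (-1) (fun c _ => by
    have := p.cases c; omega)
  simpa using this

theorem sum_le_bound (p : Profile e ℓ) (a b : ℤ) :
    ∑ c ∈ Finset.Ico a b, p.f c ≤ (b - a).toNat * ℓ := by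
  have := Finset.sum_le_card_nsmul (Finset.Ico a b) p.f ℓ (fun c _ => by
    have := p.cases c; omega)
  simpa using this

/-- Among the members below `p₀`, one with the smallest column sum is least, because its infimum
with a member not above it would have a smaller sum. The columns from `p₀.s` to `M` contain all the
variation. -/
theorem exists_least (he : 0 < e) (G : Profile e ℓ → Prop) (p₀ : Profile e ℓ) (h₀ : G p₀)
    (hinf : ∀ p r, G p → G r → G (p.inf r)) (M : ℤ) (hM : ∀ p, G p → p.s + e ≤ M) :
    ∃ p, G p ∧ ∀ r, G r → p ≤ r := by
  -- The values are at least `-1`, so adding the number of columns makes the sum nonnegative and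
  -- `toNat` loses nothing.
  let w : Profile e ℓ → ℕ := fun p =>
    (∑ c ∈ Finset.Ico p₀.s M, p.f c + (M - p₀.s).toNat).toNat
  obtain ⟨p, ⟨hp, hp0⟩, hmin⟩ : ∃ p, (G p ∧ p ≤ p₀) ∧ ∀ r, G r ∧ r ≤ p₀ → w p ≤ w r := by
    let I : Set ℕ := w '' {p | G p ∧ p ≤ p₀}
    have hI : I.Nonempty := ⟨_, p₀, ⟨h₀, le_refl _⟩, rfl⟩
    obtain ⟨p, hp, hpw⟩ := Nat.sInf_mem hI
    exact ⟨p, hp, fun r hr => hpw ▸ Nat.sInf_le ⟨r, hr, rfl⟩⟩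
  refine ⟨p, hp, fun r hr => ?_⟩
  by_contra hle
  obtain ⟨c₀, hc⟩ : ∃ c, r.f c < p.f c := by
    by_contra hcon
    push Not at hcon
    exact hle hcon
  have h1 := hmin (p.inf r) ⟨hinf p r hp hr, le_trans (inf_le_left p r) hp0⟩
  have h2 := sum_lt_sum he (inf_le_left p r) (s_anti he hp0) (hM _ (hinf p r hp hr)) (c₀ := c₀)
    (by rw [inf_f]; omega)
  have h3 := (p.inf r).sum_nonneg_bound p₀.s M
  simp only [w] at h1
  omega

theorem exists_greatest (he : 0 < e) (G : Profile e ℓ → Prop) (p₀ : Profile e ℓ) (h₀ : G p₀)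
    (hsup : ∀ p r, G p → G r → G (p.sup r)) (a : ℤ) (ha : ∀ p, G p → a ≤ p.s) :
    ∃ p, G p ∧ ∀ r, G r → r ≤ p := by
  let w : Profile e ℓ → ℕ := fun p =>
    ((p₀.s + e - a).toNat * ℓ - ∑ c ∈ Finset.Ico a (p₀.s + e), p.f c).toNat
  obtain ⟨p, ⟨hp, hp0⟩, hmin⟩ : ∃ p, (G p ∧ p₀ ≤ p) ∧ ∀ r, G r ∧ p₀ ≤ r → w p ≤ w r := by
    let I : Set ℕ := w '' {p | G p ∧ p₀ ≤ p}
    have hI : I.Nonempty := ⟨_, p₀, ⟨h₀, le_refl _⟩, rfl⟩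
    obtain ⟨p, hp, hpw⟩ := Nat.sInf_mem hI
    exact ⟨p, hp, fun r hr => hpw ▸ Nat.sInf_le ⟨r, hr, rfl⟩⟩
  refine ⟨p, hp, fun r hr => ?_⟩
  by_contra hle
  obtain ⟨c₀, hc⟩ : ∃ c, p.f c < r.f c := by
    by_contra hcon
    push Not at hcon
    exact hle hcon
  have h1 := hmin (p.sup r) ⟨hsup p r hp hr, le_trans hp0 (le_sup_left p r)⟩
  have h4 := s_anti he hp0
  have h2 := sum_lt_sum he (le_sup_left p r) (ha _ (hsup p r hp hr)) (b := p₀.s + e) (by omega)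
    (c₀ := c₀) (by rw [sup_f]; omega)
  have h3 := (p.sup r).sum_le_bound a (p₀.s + e)
  simp only [w] at h1
  omega

end Profile
end SlInfty

/-! ### Fore and aft periods as extremal profiles -/

namespace SlInfty
namespace Profile
variable {e ℓ : ℕ}

/-- A set of positions that is full far to the left and empty far to the right. -/
structure Bounded (ℓ : ℕ) (S : ℤ → ℤ → Prop) : Prop where
  full : ∃ m, ∀ c, c ≤ m → ∀ v : ℤ, 0 ≤ v → v < ℓ → S c v
  empty : ∃ m, ∀ c, m ≤ c → ∀ v, ¬ S c v

def Free (S : ℤ → ℤ → Prop) (p : ℕ → Profile e ℓ) (c v : ℤ) : Prop :=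
  S c v ∧ ∀ k, (p k).f c ≠ v

def With (F : ℤ → ℤ → Prop) (p : Profile e ℓ) (c v : ℤ) : Prop := F c v ∨ p.f c = v

/-- The profiles of the fore periods of `S`, characterized by local minimality. -/
structure Fore (S : ℤ → ℤ → Prop) (p : ℕ → Profile e ℓ) : Prop where
  on : ∀ k, (p k).On S
  before : ∀ k, (p k).Before (p (k + 1))
  least : ∀ k r, r.On (With (Free S p) (p k)) → p k ≤ r

/-- The profile of the aft period with index `k`. -/
structure Aft (S : ℤ → ℤ → Prop) (p : ℕ → Profile e ℓ) (k : ℕ) (q : Profile e ℓ) : Prop where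
  on : q.On (With (Free S p) (p k))
  before : q.Before (p (k + 1))
  greatest : ∀ r : Profile e ℓ, r.On (With (Free S p) (p k)) → r.Before (p (k + 1)) → r ≤ q

/-- Replace the beads of `q` by those of `q'`. -/
def swap (S : ℤ → ℤ → Prop) (q q' : Profile e ℓ) (c v : ℤ) : Prop :=
  (S c v ∧ q.f c ≠ v) ∨ (q'.f c = v ∧ 0 ≤ v ∧ v < ℓ)

variable {S : ℤ → ℤ → Prop} {p : ℕ → Profile e ℓ}

theorem On.s_le (he : 0 < e) {r : Profile e ℓ} (hr : r.On S) {M : ℤ}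
    (hM : ∀ c, M ≤ c → ∀ v, ¬ S c v) : r.s + e ≤ M := by
  by_contra h
  have h1 := r.mid (r.s + e - 1) (by omega) (by omega)
  exact hM _ (by omega) _ (hr _ h1.1 h1.2)

theorem Before.trans {p q r : Profile e ℓ} (h : p.Before q) (h' : q.Before r) : p.Before r :=
  h.of_le (le_refl p) h'.1

theorem before_of_lt (h : ∀ k, (p k).Before (p (k + 1))) {k m : ℕ} (hkm : k < m) :
    (p k).Before (p m) := by
  induction m, hkm using Nat.le_induction with
  | base => exact h k
  | succ m _ ih => exact ih.trans (h m)

theorem Fore.before_of_lt (h : Fore S p) {k m : ℕ} (hkm : k < m) : (p k).Before (p m) :=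
  Profile.before_of_lt h.before hkm

theorem Fore.disj (h : Fore S p) {k m : ℕ} (hkm : k ≠ m) : (p k).Disj (p m) := by
  rcases lt_or_gt_of_ne hkm with h1 | h1
  · exact (h.before_of_lt h1).2
  · exact (h.before_of_lt h1).2.symm

theorem Fore.le_of_le (h : Fore S p) {k m : ℕ} (hkm : k ≤ m) : p k ≤ p m := by
  rcases hkm.eq_or_lt with rfl | h1
  · exact le_refl _
  · exact (h.before_of_lt h1).1

/-- Each step of the chain raises the column sum over the window by at least one, and the sum lies
between `-(M - a)` and `(M - a) * ℓ`. -/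
theorem le_bound_of_chain (he : 0 < e) (h : ∀ k, (p k).Before (p (k + 1))) {M a : ℤ}
    (hM : ∀ k, (p k).s + e ≤ M) {n : ℕ} (ha : ∀ k ≤ n, a ≤ (p k).s) :
    n ≤ (M - a).toNat * (ℓ + 1) := by
  have key : ∀ k ≤ n, (k : ℤ) - (M - a).toNat ≤ ∑ c ∈ Finset.Ico a M, (p k).f c := by
    intro k
    induction k with
    | zero => intro _; have := (p 0).sum_nonneg_bound a M; push_cast; omega
    | succ k ih =>
      intro hk
      have h1 := ih (by omega)
      have h2 : (p k).f (p k).s < (p (k + 1)).f (p k).s := by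
        have := (p k).cases (p k).s
        have h3 := (h k).1 (p k).s
        have h4 := (h k).2.ne_or (p k).s
        omega
      have h3 := sum_lt_sum he (h k).1 (ha (k + 1) hk) (hM k) h2
      push_cast
      omega
  have h1 := key n le_rfl
  have h2 := (p n).sum_le_bound a M
  zify
  rw [mul_add]
  omega

/-- Such an `r` would lie above every `p k` by minimality, and an infinite strict chain does not fit
below `r`. Most contradictions below come from building a quasiperiod of free beads. -/
theorem Fore.not_on_free (he : 0 < e) (h : Fore S p) (hS : Bounded ℓ S) (r : Profile e ℓ) :
    ¬ r.On (Free S p) := by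
  intro hr
  obtain ⟨M, hM⟩ := hS.empty
  have h1 : ∀ k, p k ≤ r := fun k => h.least k r (hr.mono fun c v _ _ _ hv => Or.inl hv)
  have := le_bound_of_chain he h.before (fun k => (h.on k).s_le he hM) (a := r.s)
    (n := (M - r.s).toNat * (ℓ + 1) + 1) (fun k _ => s_anti he (h1 k))
  omega

/-- Local minimality implies the greedy choice. The beads of `(p k).inf r` strictly below `p k` are
free: they miss the earlier fore periods by disjointness, and the later ones because those are above
`p k`. -/
theorem Fore.le_of_disj (h : Fore S p) {k : ℕ} {r : Profile e ℓ} (hr : r.On S)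
    (hd : ∀ m < k, (p m).Disj r) : p k ≤ r := by
  have h1 : ((p k).inf r).On (With (Free S p) (p k)) := by
    refine On.inf (fun c _ _ => Or.inr rfl) fun c h0 h1 hlt => Or.inl ⟨hr c h0 h1, fun m hm => ?_⟩
    rcases lt_or_ge m k with hmk | hmk
    · exact hd m hmk c hm (by omega) (by omega)
    · have := h.le_of_le hmk c
      omega
  exact le_trans (h.least k _ h1) (inf_le_right _ _)

theorem Fore.unique (he : 0 < e) {p' : ℕ → Profile e ℓ} (h : Fore S p) (h' : Fore S p') :
    p = p' := by
  funext k
  induction k using Nat.strong_induction_on with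
  | _ k ih =>
    apply le_antisymm he
    · exact h.le_of_disj (h'.on k) fun m hm => ih m hm ▸ h'.disj hm.ne
    · exact h'.le_of_disj (h.on k) fun m hm => ih m hm ▸ h.disj hm.ne

/-- The beads of one row in `e` consecutive columns. -/
def flat (e : ℕ) {ℓ : ℕ} (hℓ : 0 < ℓ) (s : ℤ) : Profile e ℓ where
  f c := if c < s then -1 else if c < s + e then 0 else ℓ
  s := s
  mono c := by split_ifs <;> omega
  left c h := by simp [h]
  mid c h h' := by simp [h', hℓ, not_lt.2 h]
  right c h := by rw [if_neg (by omega), if_neg (by omega)]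

theorem Bounded.exists_least (he : 0 < e) (hℓ : 0 < ℓ) (hS : Bounded ℓ S) :
    ∃ p : Profile e ℓ, p.On S ∧ ∀ r : Profile e ℓ, r.On S → p ≤ r := by
  obtain ⟨M, hM⟩ := hS.empty
  obtain ⟨m, hm⟩ := hS.full
  refine Profile.exists_least he (fun r => r.On S) (flat e hℓ (m - e)) ?_ ?_ M
    fun p hp => hp.s_le he hM
  · intro c h0 h1
    have := (flat e hℓ (m - e)).cases c
    have hs : (flat e hℓ (m - e)).s = m - e := rfl
    exact hm c (by omega) _ h0 h1
  · exact fun p r hp hr => hp.inf fun c h0 h1 _ => hr c h0 h1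

theorem Bounded.diff (hS : Bounded ℓ S) (q : Profile e ℓ) :
    Bounded ℓ (fun c v => S c v ∧ q.f c ≠ v) := by
  obtain ⟨M, hM⟩ := hS.empty
  obtain ⟨m, hm⟩ := hS.full
  refine ⟨⟨min m (q.s - 1), fun c hc v h0 h1 => ⟨hm c (by omega) v h0 h1, ?_⟩⟩,
    M, fun c hc v h => hM c hc v h.1⟩
  have := q.cases c
  omega

theorem Bounded.swap (hS : Bounded ℓ S) (q q' : Profile e ℓ) :
    Bounded ℓ (swap S q q') := by
  obtain ⟨M, hM⟩ := (hS.diff q).empty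
  obtain ⟨m, hm⟩ := (hS.diff q).full
  refine ⟨⟨m, fun c hc v h0 h1 => Or.inl (hm c hc v h0 h1)⟩,
    max M (q'.s + e), fun c hc v h => ?_⟩
  rcases h with h | h
  · exact hM c (by omega) v h
  · have := q'.cases c
    omega

/-- Greedy construction: the least profile is taken and its beads are removed, repeatedly. -/
theorem exists_fore (he : 0 < e) (hℓ : 0 < ℓ) (hS : Bounded ℓ S) :
    ∃ p : ℕ → Profile e ℓ, Fore S p := by
  choose g hg using fun T : {T // Bounded ℓ T} => T.2.exists_least (e := e) he hℓ
  let T : ℕ → {T // Bounded ℓ T} := fun n =>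
    Nat.rec ⟨S, hS⟩ (fun _ T => ⟨fun c v => T.1 c v ∧ (g T).f c ≠ v, T.2.diff (g T)⟩) n
  have hT : ∀ n c v, (T n).1 c v ↔ S c v ∧ ∀ m < n, (g (T m)).f c ≠ v := by
    intro n c v
    induction n with
    | zero => simp [T]
    | succ n ih =>
      change ((T n).1 c v ∧ (g (T n)).f c ≠ v) ↔ _
      rw [ih, and_assoc]
      refine and_congr_right fun _ => ⟨fun h m hm => ?_, fun h => ⟨fun m hm => h m (by omega), h n (by omega)⟩⟩
      rcases Nat.lt_succ_iff_lt_or_eq.1 hm with h1 | rfl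
      · exact h.1 m h1
      · exact h.2
  refine ⟨fun n => g (T n), fun k c h0 h1 => ((hT k _ _).1 ((hg (T k)).1 c h0 h1)).1, fun k => ⟨?_, ?_⟩,
    fun k r hr => (hg (T k)).2 r fun c h0 h1 => ?_⟩
  · exact (hg (T k)).2 _ fun c h0 h1 => ((hg (T (k + 1))).1 c h0 h1).1
  · intro c h1 h2 h3
    exact ((hg (T (k + 1))).1 c (by omega) (by omega)).2 h1
  · rcases hr c h0 h1 with h | h
    · exact (hT k _ _).2 ⟨h.1, fun m _ => h.2 m⟩
    · rw [← h]
      exact (hg (T k)).1 c (by omega) (by omega)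

/-- The candidates are closed under suprema and bounded above by `p (k + 1)`; `p k` itself is one.
-/
theorem Fore.exists_aft (he : 0 < e) (h : Fore S p) (k : ℕ) : ∃ q, Aft S p k q := by
  obtain ⟨q, hq, hmax⟩ := exists_greatest he
    (fun r => r.On (With (Free S p) (p k)) ∧ r.Before (p (k + 1))) (p k)
    ⟨fun c _ _ => Or.inr rfl, h.before k⟩
    (fun q r hq hr => ⟨hq.1.sup hr.1, fun c => max_le (hq.2.1 c) (hr.2.1 c), fun c h1 h2 h3 => by
      have a1 := hq.2.1 c
      have a2 := hr.2.1 c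
      have a3 := hq.2.2.ne_or c
      have a4 := hr.2.2.ne_or c
      rw [sup_f] at *
      omega⟩) (p (k + 1)).s (fun r hr => s_anti he hr.2.1)
  exact ⟨q, hq.1, hq.2, fun r hr hr' => hmax r ⟨hr, hr'⟩⟩

theorem Aft.le {k : ℕ} {q : Profile e ℓ} (h : Fore S p) (hq : Aft S p k q) : p k ≤ q :=
  h.least k q hq.on

theorem Aft.unique (he : 0 < e) {k : ℕ} {q q' : Profile e ℓ} (hq : Aft S p k q)
    (hq' : Aft S p k q') : q = q' :=
  le_antisymm he (hq'.greatest q hq.on hq.before) (hq.greatest q' hq'.on hq'.before)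

/-- The free positions after the profile with index `k` has been replaced. -/
theorem Free.update {k : ℕ} {S' : ℤ → ℤ → Prop} {p' : Profile e ℓ} {c v : ℤ} :
    Free S' (Function.update p k p') c v ↔
      S' c v ∧ p'.f c ≠ v ∧ ∀ m, m ≠ k → (p m).f c ≠ v := by
  refine and_congr_right fun _ => ⟨fun h => ⟨?_, fun m hm => ?_⟩, fun h m => ?_⟩
  · simpa using h k
  · simpa [hm] using h m
  · by_cases hm : m = k
    · subst hm
      simpa using h.1
    · simpa [hm] using h.2 m hm

theorem before_update {k : ℕ} {p' : Profile e ℓ} (h : ∀ m, (p m).Before (p (m + 1)))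
    (h1 : ∀ m < k, (p m).Before p') (h2 : p'.Before (p (k + 1))) (m : ℕ) :
    (Function.update p k p' m).Before (Function.update p k p' (m + 1)) := by
  by_cases hm : m = k
  · subst hm
    simpa using h2
  by_cases hm' : m + 1 = k
  · subst hm'
    simpa using h1 m (by omega)
  · simpa [hm, hm'] using h m

/-! ### Walls and the shifts of fore and aft periods -/

/-- No bead lies in the wall between the fore period `p k` and its right shift. -/
theorem Fore.wall (he : 0 < e) (h : Fore S p) {k : ℕ} (hk : ∀ m < k, (p m).Before (p k).shR)
    {c v : ℤ} (h0 : 0 ≤ v) (h1 : v < ℓ) (hv : S c v) (hne : (p k).f c ≠ v) :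
    (p k).f c < v ∨ v < (p k).f (c - 1) := by
  by_cases hf : ∀ m, (p m).f c ≠ v
  · by_contra hcon
    -- A free bead in the wall could replace a bead of `p k`, contradicting minimality.
    obtain ⟨r, hr, hr'⟩ := (p k).exists_lower he c v h0 h1 (by omega) (by omega)
    have := h.least k r (fun c' a0 a1 => by
      by_cases hc : c' = c
      · subst hc
        rw [hr]
        exact Or.inl ⟨hv, hf⟩
      · rcases hr' c' hc with h2 | h2
        · exact Or.inr h2.symm
        · omega) c
    omega
  · push Not at hf
    obtain ⟨m, hm⟩ := hf
    rcases lt_trichotomy m k with hmk | rfl | hmk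
    · have a1 := (hk m hmk).1 c
      have a2 := (hk m hmk).2.ne_or c
      rw [shR_f] at *
      omega
    · exact absurd hm hne
    · have a1 := (h.before_of_lt hmk).1 c
      omega

/-- The fore period `p k` can be shifted to the right if the shift is behind the previous ones.
The shift is the aft period, and the other fore periods remain. -/
theorem Fore.shiftRight (he : 0 < e) (hS : Bounded ℓ S) (h : Fore S p) {k : ℕ}
    (hk : ∀ m < k, (p m).Before (p k).shR) :
    ∃ p', Fore (swap S (p k) (p k).shR) (Function.update p k p') ∧
      Aft (swap S (p k) (p k).shR) (Function.update p k p') k (p k).shR := by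
  obtain ⟨M, hM⟩ := hS.empty
  -- The new fore period need not be the shift itself: the shifted beads join the free ones, and the
  -- least profile in the union takes over.
  obtain ⟨p', hp', hmin⟩ := exists_least he (fun r => r.On (With (Free S p) (p k).shR)) (p k).shR
    (fun c _ _ => Or.inr rfl) (fun q r hq hr => hq.inf fun c h0 h1 _ => hr c h0 h1)
    (max M ((p k).shR.s + e)) (fun r hr => On.s_le (S := fun c v => S c v ∨
      (c < (p k).shR.s + e ∧ (p k).shR.f c = v)) he (hr.mono fun c v _ h0 h1 hv => by
        rcases hv with hv | hv
        · exact Or.inl hv.1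
        · have := (p k).shR.cases c
          exact Or.inr ⟨by omega, hv⟩)
      fun c hc v hv => by
        rcases hv with hv | hv
        · exact hM c (by omega) v hv
        · omega)
  have hw : ∀ c v : ℤ, 0 ≤ v → v < ℓ → S c v → (p k).f c ≠ v → (p k).f c < v ∨ v < (p k).f (c - 1) :=
    fun c v h0 h1 => h.wall he hk h0 h1
  have hp'le : p' ≤ (p k).shR := hmin _ fun c _ _ => Or.inr rfl
  have hp'k : p' ≤ p k := le_trans hp'le (p k).shR_le
  -- the free beads after the shift
  have hfree : ∀ c v : ℤ, 0 ≤ v → v < ℓ →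
      (Free (swap S (p k) (p k).shR) (Function.update p k p') c v ↔
      With (Free S p) (p k).shR c v ∧ p'.f c ≠ v) := by
    intro c v h0 h1
    rw [Free.update]
    constructor
    · rintro ⟨h2 | h2, h3, h4⟩
      · refine ⟨Or.inl ⟨h2.1, fun m => ?_⟩, h3⟩
        by_cases hm : m = k
        · subst hm; exact h2.2
        · exact h4 m hm
      · exact ⟨Or.inr h2.1, h3⟩
    · rintro ⟨h2 | h2, h3⟩
      · exact ⟨Or.inl ⟨h2.1, h2.2 k⟩, h3, fun m _ => h2.2 m⟩
      · refine ⟨Or.inr ⟨h2, h0, h1⟩, h3, fun m hm hmv => ?_⟩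
        rcases lt_or_gt_of_ne hm with hmk | hmk
        · exact (hk m hmk).2 c (by omega) (by omega) (by omega)
        · have a1 := (h.before_of_lt hmk).1 c
          have a2 := (h.before_of_lt hmk).2.ne_or c
          have a3 := (p k).mono' c
          rw [shR_f] at h2
          omega
  have hSlt : ∀ m < k, (p m).Before p' := by
    intro m hm
    have h1 : p m ≤ p' := by
      refine le_trans (h.least m ((p m).inf p') ?_) (inf_le_right _ _)
      refine On.inf (fun c _ _ => Or.inr rfl) fun c h0 h1 hlt => ?_
      rcases hp' c h0 h1 with h2 | h2
      · exact Or.inl h2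
      · have := (hk m hm).1 c
        omega
    refine ⟨h1, fun c h2 h3 h4 => ?_⟩
    rcases hp' c (by omega) (by omega) with h5 | h5
    · exact h5.2 m h2
    · exact (hk m hm).2 c (by omega) h3 h4
  have hSgt : p'.Before (p (k + 1)) := (h.before k).of_le hp'k (le_refl _)
  -- By the wall, a quasiperiod of the new abacus cannot straddle the shifted period.
  have side : ∀ r : Profile e ℓ, r.On (swap S (p k) (p k).shR) → (p k).Before r ∨ r ≤ (p k).shR := by
    intro r hr
    refine before_or_le_shR he fun c h0 h1 => ?_
    rcases hr c h0 h1 with h2 | h2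
    · have := hw c _ h0 h1 h2.1 h2.2
      omega
    · rw [shR_f] at h2
      omega
  have hupk : Function.update p k p' k = p' := Function.update_self ..
  have hupm : ∀ m, m ≠ k → Function.update p k p' m = p m := fun m hm => Function.update_of_ne hm ..
  have hup : ∀ r : Profile e ℓ,
      r.On (With (Free (swap S (p k) (p k).shR) (Function.update p k p')) p') ↔ r.On (With (Free S p) (p k).shR) := by
    intro r
    refine forall_congr' fun c => forall_congr' fun h0 => forall_congr' fun h1 => ?_
    unfold With
    rw [hfree c _ h0 h1]
    constructor
    · rintro (h2 | h2)
      · exact h2.1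
      · rw [← h2]; exact hp' c (by omega) (by omega)
    · intro h2
      by_cases h3 : p'.f c = r.f c
      · exact Or.inr h3
      · exact Or.inl ⟨h2, h3⟩
  refine ⟨p', ⟨fun m => ?_, before_update h.before hSlt hSgt, fun m r hr => ?_⟩, ?_, ?_, ?_⟩
  · by_cases hm : m = k
    · rw [hm, hupk]
      intro c h0 h1
      rcases hp' c h0 h1 with h2 | h2
      · exact Or.inl ⟨h2.1, h2.2 k⟩
      · exact Or.inr ⟨h2, h0, h1⟩
    · rw [hupm m hm]
      exact fun c h0 h1 => Or.inl ⟨h.on m c h0 h1, fun h2 => h.disj (Ne.symm hm) c h2 (by omega) (by omega)⟩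
  · rcases lt_trichotomy m k with hm | rfl | hm
    · rw [hupm m hm.ne] at hr ⊢
      refine le_trans (h.least m ((p m).inf r) ?_) (inf_le_right _ _)
      refine On.inf (fun c _ _ => Or.inr rfl) fun c h0 h1 hlt => ?_
      rcases hr c h0 h1 with h2 | h2
      · rcases ((hfree c _ h0 h1).1 h2).1 with h3 | h3
        · exact Or.inl h3
        · have := (hk m hm).1 c
          omega
      · omega
    · rw [hupk] at hr ⊢
      exact hmin r ((hup r).1 hr)
    · rw [hupm m hm.ne'] at hr ⊢
      have hmk := h.before_of_lt hm
      rcases side r (hr.mono fun c v hv h0 h1 hw' => by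
        rcases hw' with h2 | h2
        · exact h2.1
        · exact Or.inl ⟨by have := h.on m c (by omega) (by omega); rwa [h2] at this,
            fun h3 => hmk.2 c (by omega) (by omega) (by omega)⟩) with h2 | h2
      · refine h.least m r fun c h0 h1 => ?_
        rcases hr c h0 h1 with h3 | h3
        · rcases ((hfree c _ h0 h1).1 h3).1 with h4 | h4
          · exact Or.inl h4
          · have a1 := h2.1 c
            have a2 := h2.2.ne_or c
            have a3 := (p k).mono' c
            rw [shR_f] at h4
            omega
        · exact Or.inr h3
      · exfalso
        -- Such an `r` avoids `p'` and competes with it, so `p' ≤ r ≤ (p k).shR`. Then `p'` contains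
        -- no bead of the shift, since `r` would share it, and `p'` consists of free beads of `S`.
        have h3 : r.On (fun c v => With (Free S p) (p k).shR c v ∧ p'.f c ≠ v) := by
          intro c h0 h1
          rcases hr c h0 h1 with h3 | h3
          · exact (hfree c _ h0 h1).1 h3
          · have a1 := hmk.1 c
            have a2 := hmk.2.ne_or c
            have a3 := h2 c
            have a4 := (p k).mono' c
            rw [shR_f] at a3
            omega
        have h4 : p' ≤ r := hmin r (h3.mono fun c v _ _ _ h5 => h5.1)
        refine h.not_on_free he hS p' fun c h0 h1 => ?_
        rcases hp' c h0 h1 with h5 | h5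
        · exact h5
        · have a1 := h4 c
          have a2 := h2 c
          have a3 := h3 c (by omega) (by omega)
          omega
  · rw [hupk, hup]
    exact fun c _ _ => Or.inr rfl
  · rw [hupm (k + 1) (by omega)]
    exact (h.before k).of_le (p k).shR_le (le_refl _)
  · intro r hr _
    rw [hupk, hup] at hr
    rcases side r (fun c h0 h1 => by
      rcases hr c h0 h1 with h2 | h2
      · exact Or.inl ⟨h2.1, h2.2 k⟩
      · exact Or.inr ⟨h2, h0, h1⟩) with h2 | h2
    · exfalso
      refine h.not_on_free he hS r fun c h0 h1 => ?_
      rcases hr c h0 h1 with h3 | h3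
      · exact h3
      · have a1 := h2.1 c
        have a2 := h2.2.ne_or c
        have a3 := (p k).mono' c
        rw [shR_f] at h3
        omega
    · exact h2

/-- No bead lies in the wall between an aft period and its left shift. -/
theorem Fore.wall_aft (he : 0 < e) (h : Fore S p) {k : ℕ} {q : Profile e ℓ} (hq : Aft S p k q)
    (hk : q.Before (p (k + 1)).shR)
    {c v : ℤ} (h0 : 0 ≤ v) (h1 : v < ℓ) (hv : S c v) (hne : q.f c ≠ v) :
    q.f (c + 1) < v ∨ v < q.f c := by
  have hk' := before_shR_iff.1 hk
  by_cases hf : ∀ m, m ≠ k → (p m).f c ≠ v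
  · by_contra hcon
    -- A bead in the wall that is free or in `p k` would yield a candidate not below `q`. The
    -- candidate remains before `p (k + 1)` because `q.shL` is before it.
    obtain ⟨r, hr, hr'⟩ := q.exists_raise he c v h0 h1 (by omega) (by omega)
    have := hq.greatest r (fun c' a0 a1 => by
      by_cases hc : c' = c
      · subst hc
        rw [hr]
        by_cases hkv : (p k).f c' = v
        · exact Or.inr hkv
        · exact Or.inl ⟨hv, fun m => by
            by_cases hm : m = k
            · rwa [hm]
            · exact hf m hm⟩
      · rcases hr' c' hc with h2 | h2
        · rw [h2]
          exact hq.on c' (by omega) (by omega)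
        · omega) ⟨fun c' => by
          by_cases hc : c' = c
          · subst hc
            have := hk'.1 c'
            rw [shL_f] at this
            omega
          · rcases hr' c' hc with h2 | h2
            · rw [h2]
              exact hq.before.1 c'
            · have := hk'.1 c'
              rw [shL_f] at this
              omega, fun c' a1 a2 a3 => by
          by_cases hc : c' = c
          · subst hc
            exact hf (k + 1) (by omega) (by omega)
          · rcases hr' c' hc with h2 | h2
            · exact hq.before.2 c' (by omega) (by omega) (by omega)
            · omega⟩ c
    omega
  · push Not at hf
    obtain ⟨m, hmk, hm⟩ := hf
    rcases lt_or_gt_of_ne hmk with hmk | hmk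
    · have a1 := (h.before_of_lt hmk).1 c
      have a2 := hq.le h c
      omega
    · have a1 := h.le_of_le (show k + 1 ≤ m by omega) c
      have a2 := hk'.1 c
      have a3 := hk'.2.ne_or c
      rw [shL_f] at *
      omega

/-- The aft period can be shifted to the left if the next fore period is behind the shift. The shift
is a fore period, and the other fore periods remain. -/
theorem Fore.shiftLeft (he : 0 < e) (hS : Bounded ℓ S) (h : Fore S p) {k : ℕ}
    {q : Profile e ℓ} (hq : Aft S p k q) (hk : q.Before (p (k + 1)).shR) :
    Fore (swap S q q.shL) (Function.update p k q.shL) := by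
  have hk' := before_shR_iff.1 hk
  have hle := hq.le h
  have hw : ∀ c v : ℤ, 0 ≤ v → v < ℓ → S c v → q.f c ≠ v → q.f (c + 1) < v ∨ v < q.f c :=
    fun c v h0 h1 => h.wall_aft he hq hk h0 h1
  have hqm : ∀ m, m ≠ k → (p m).Disj q := by
    intro m hm c h1 h2 h3
    rcases hq.on c (by omega) (by omega) with h4 | h4
    · exact h4.2 m h1
    · exact h.disj hm c (by omega) h2 h3
  have hlt : ∀ m < k, (p m).Before q.shL := fun m hm =>
    (h.before_of_lt hm).of_le (le_refl _) (le_trans hle q.le_shL)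
  -- the free beads after the shift
  have hfree : ∀ c v : ℤ, 0 ≤ v → v < ℓ →
      Free (swap S q q.shL) (Function.update p k q.shL) c v →
      With (Free S p) (p k) c v ∧ q.f c ≠ v := by
    intro c v h0 h1
    rw [Free.update]
    rintro ⟨h2 | h2, h3, h4⟩
    · refine ⟨?_, h2.2⟩
      by_cases hkv : (p k).f c = v
      · exact Or.inr hkv
      · exact Or.inl ⟨h2.1, fun m => by
          by_cases hm : m = k
          · rwa [hm]
          · exact h4 m hm⟩
    · exact absurd h2.1 h3
  -- The beads outside `q` contain no second quasiperiod. Otherwise `r.sup q` would be made of free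
  -- beads: it meets `p k` only where `r` and `q` coincide, which is excluded.
  have hnone : ∀ r : Profile e ℓ, ¬ r.On (fun c v => With (Free S p) (p k) c v ∧ q.f c ≠ v) := by
    intro r hr
    have h1 : p k ≤ r := h.least k r (hr.mono fun c v _ _ _ h2 => h2.1)
    refine h.not_on_free he hS (r.sup q) fun c h2 h3 => ?_
    rw [sup_f] at *
    have a1 := h1 c
    have a2 := hle c
    rcases le_or_gt (r.f c) (q.f c) with h4 | h4
    · rw [max_eq_right h4] at *
      rcases hq.on c h2 h3 with h5 | h5
      · exact h5
      · have h6 := hr c (by omega) (by omega)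
        omega
    · rw [max_eq_left h4.le] at *
      rcases (hr c h2 h3).1 with h5 | h5
      · exact h5
      · omega
  have side : ∀ r : Profile e ℓ, r.On (fun c v => (S c v ∧ q.f c ≠ v) ∨ q.shL.f c = v) →
      q.shL ≤ r ∨ r.Before q := by
    intro r hr
    have := le_or_before_shR he (p := q.shL) (r := r) fun c h0 h1 => by
      rw [shL_f, shL_f, sub_add_cancel]
      rcases hr c h0 h1 with h2 | h2
      · have := hw c _ h0 h1 h2.1 h2.2
        omega
      · rw [shL_f] at h2
        omega
    rwa [shR_shL he] at this
  have hupk : Function.update p k q.shL k = q.shL := Function.update_self ..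
  have hupm : ∀ m, m ≠ k → Function.update p k q.shL m = p m :=
    fun m hm => Function.update_of_ne hm ..
  refine ⟨fun m => ?_, before_update h.before hlt hk', fun m r hr => ?_⟩
  · by_cases hm : m = k
    · rw [hm, hupk]
      exact fun c h0 h1 => Or.inr ⟨rfl, h0, h1⟩
    · rw [hupm m hm]
      exact fun c h0 h1 => Or.inl ⟨h.on m c h0 h1, fun h2 => hqm m hm c h2.symm h0 h1⟩
  · have hr2 : r.On (fun c v => (With (Free S p) (p k) c v ∧ q.f c ≠ v) ∨
        (Function.update p k q.shL m).f c = v) := by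
      intro c h0 h1
      exact (hr c h0 h1).imp (hfree c _ h0 h1) id
    have hon : ∀ c v : ℤ, 0 ≤ v → v < ℓ → With (Free S p) (p k) c v → S c v := by
      rintro c v h0 h1 (h2 | h2)
      · exact h2.1
      · rw [← h2]
        exact h.on k c (by omega) (by omega)
    rcases lt_trichotomy m k with hm | rfl | hm
    · rw [hupm m hm.ne] at hr2 ⊢
      refine le_trans (h.least m ((p m).inf r) ?_) (inf_le_right _ _)
      refine On.inf (fun c _ _ => Or.inr rfl) fun c h0 h1 hlt => ?_
      rcases hr2 c h0 h1 with h2 | h2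
      · rcases h2.1 with h3 | h3
        · exact Or.inl h3
        · have := (h.before_of_lt hm).1 c
          omega
      · omega
    · rw [hupk] at hr2 ⊢
      rcases side r (hr2.mono fun c v _ h0 h1 h2 =>
        h2.imp (fun h3 => ⟨hon c v h0 h1 h3.1, h3.2⟩) id) with h2 | h2
      · exact h2
      · refine absurd (fun c h0 h1 => ?_) (hnone r)
        rcases hr2 c h0 h1 with h3 | h3
        · exact h3
        · have a1 := h2.1 c
          have a2 := h2.2.ne_or c
          have a3 := q.mono c
          rw [shL_f] at h3
          omega
    · rw [hupm m hm.ne'] at hr2 ⊢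
      have a0 : (p (k + 1)) ≤ p m := h.le_of_le hm
      rcases side r (hr2.mono fun c v hv h0 h1 h2 => Or.inl <| by
        rcases h2 with h3 | h3
        · exact ⟨hon c v h0 h1 h3.1, h3.2⟩
        · exact ⟨by have := h.on m c (by omega) (by omega); rwa [h3] at this,
            fun h4 => hqm m hm.ne' c (by omega) (by omega) (by omega)⟩) with h2 | h2
      · refine h.least m r fun c h0 h1 => ?_
        rcases hr2 c h0 h1 with h3 | h3
        · rcases h3.1 with h4 | h4
          · exact Or.inl h4
          · have a1 := h2 c
            have a2 := hle c
            have a3 := q.mono c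
            rw [shL_f] at a1
            omega
        · exact Or.inr h3
      · refine absurd (fun c h0 h1 => ?_) (hnone r)
        rcases hr2 c h0 h1 with h3 | h3
        · exact h3
        · have a1 := h2.1 c
          have a2 := h2.2.ne_or c
          have a3 := hq.before.1 c
          have a4 := a0 c
          omega

/-- The aft period avoids the wall between `p (k + 1)` and its right shift, hence lies on one side.
Being before `p (k + 1)`, it cannot be weakly above it. So looseness can be tested on fore periods
alone. -/
theorem Fore.aft_before (he : 0 < e) (h : Fore S p) {k : ℕ} {q : Profile e ℓ} (hq : Aft S p k q)
    (hk : (p k).Before (p (k + 1)).shR) : q.Before (p (k + 1)).shR := by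
  have hk' : ∀ m < k + 1, (p m).Before (p (k + 1)).shR := fun m hm =>
    hk.of_le (h.le_of_le (by omega)) (le_refl _)
  rcases le_or_before_shR he (p := p (k + 1)) (r := q) fun c h0 h1 => by
    have h2 : S c (q.f c) ∧ (p (k + 1)).f c ≠ q.f c := by
      refine ⟨?_, fun h3 => hq.before.2 c h3.symm h0 h1⟩
      rcases hq.on c h0 h1 with h2 | h2
      · exact h2.1
      · rw [← h2]
        exact h.on k c (by omega) (by omega)
    have := h.wall he hk' h0 h1 h2.1 h2.2
    omega with h1 | h1
  · exact absurd (hq.before.of_le (le_refl _) h1) (not_before_self he _)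
  · exact h1

/-- The converse of `Fore.shiftLeft`. The fore periods with index below `k` are unchanged, and `p (k
+ 1)` survives as a quasiperiod disjoint from them, so it is above the new fore period `q.shL`.
Disjointness from `q.shL` follows from `hvac`: a common position would already be a bead of `q`. -/
theorem Fore.before_of_shiftLeft {q : Profile e ℓ} {k : ℕ} {P : ℕ → Profile e ℓ} (he : 0 < e)
    (h : Fore S p) (hq : Aft S p k q)
    (hvac : ∀ c, 0 ≤ q.f (c + 1) → q.f (c + 1) < ℓ → S c (q.f (c + 1)) → q.f c = q.f (c + 1))
    (hP : Fore (swap S q q.shL) P) (hk : P k = q.shL) : (p k).Before (p (k + 1)).shR := by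
  have hle := hq.le h
  have hqm : ∀ m, m ≠ k → (p m).Disj q := by
    intro m hm c h1 h2 h3
    rcases hq.on c (by omega) (by omega) with h4 | h4
    · exact h4.2 m h1
    · exact h.disj hm c (by omega) h2 h3
  have hon : ∀ m, m ≠ k → (p m).On (swap S q q.shL) := fun m hm c h0 h1 =>
    Or.inl ⟨h.on m c h0 h1, fun h2 => hqm m hm c h2.symm h0 h1⟩
  have heq : ∀ m < k, P m = p m := by
    intro m
    induction m using Nat.strong_induction_on with
    | _ m ih =>
      intro hm
      apply le_antisymm he
      · exact hP.le_of_disj (hon m hm.ne) fun i hi => ih i hi (hi.trans hm) ▸ h.disj hi.ne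
      · refine h.le_of_disj (fun c h0 h1 => ?_) fun i hi => ih i hi (hi.trans hm) ▸ hP.disj hi.ne
        rcases hP.on m c h0 h1 with h2 | h2
        · exact h2.1
        · exact absurd (hP.disj hm.ne c (by rw [hk]; exact h2.1.symm) h0 h1) id
  have h1 : q.shL.Before (p (k + 1)) := by
    have hd : q.shL.Disj (p (k + 1)) := by
      intro c h2 h3 h4
      have h5 := h.on (k + 1) c (by omega) (by omega)
      rw [← h2, shL_f] at h5
      rw [shL_f] at h2 h3 h4
      have h6 := hvac c h3 h4 h5
      exact hqm (k + 1) (by omega) c (by omega) (by omega) (by omega)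
    refine ⟨?_, hd⟩
    rw [← hk]
    refine hP.le_of_disj (hon _ (by omega)) fun m hm => ?_
    rw [heq m hm]
    exact h.disj (by omega)
  exact (before_shR_iff.2 h1).of_le hle (le_refl _)

/-- Fore periods to the left of all the gaps are packed. -/
theorem Fore.not_before_shR (he : 0 < e) (h : Fore S p) {m : ℤ}
    (hm : ∀ c, c ≤ m → ∀ v : ℤ, 0 ≤ v → v < ℓ → S c v) {k : ℕ} (hk : (p k).s ≤ m + 1) :
    ¬ (p k).Before (p (k + 1)).shR := by
  intro hb
  obtain ⟨q, hq⟩ := h.exists_aft he k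
  have h1 := s_anti he (hq.le h)
  have h2 := q.cases q.s
  have h3 := q.cases (q.s - 1)
  -- The position to the left of the leftmost bead of `q`, in the same row, lies in the wall but is
  -- filled.
  have h4 := h.wall_aft he hq (h.aft_before he hq hb) (c := q.s - 1) (v := q.f q.s) (by omega)
    (by omega) (hm _ (by omega) _ (by omega) (by omega)) (by omega)
  rw [sub_add_cancel] at h4
  omega

/-- Only finitely many fore periods can start to the right of the full columns, by
`le_bound_of_chain`. -/
theorem Fore.exists_not_before_shR (he : 0 < e) (h : Fore S p) (hS : Bounded ℓ S) :
    ∃ K, ∀ k, K ≤ k → ¬ (p k).Before (p (k + 1)).shR := by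
  obtain ⟨M, hM⟩ := hS.empty
  obtain ⟨m, hm⟩ := hS.full
  refine ⟨(M - (m + 1)).toNat * (ℓ + 1) + 1, fun k hk => h.not_before_shR he hm ?_⟩
  by_contra hcon
  have := le_bound_of_chain he h.before (fun k => (h.on k).s_le he hM) (a := m + 1) (n := k)
    (fun i hi => by have := s_anti he (h.le_of_le hi); omega)
  omega

end Profile
end SlInfty

namespace SlInfty

/-! ### Profiles and tuples of positions -/

/-- A set of positions as a predicate on pairs of integers. -/
def rowsOf {ℓ : ℕ} (T : Set (Pos ℓ)) (c v : ℤ) : Prop := ∃ x : Fin ℓ, ((x : ℕ) : ℤ) = v ∧ (c, x) ∈ T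

theorem rowsOf_coe {ℓ : ℕ} {T : Set (Pos ℓ)} {c : ℤ} {x : Fin ℓ} :
    rowsOf T c (x : ℕ) ↔ (c, x) ∈ T := by
  refine ⟨fun ⟨y, hy, h⟩ => ?_, fun h => ⟨x, rfl, h⟩⟩
  have : y = x := Fin.ext (by exact_mod_cast hy)
  rwa [← this]

namespace Profile
variable {e ℓ : ℕ}

/-- The quasiperiod with a given profile. -/
def tuple (p : Profile e ℓ) : Fin e → Pos ℓ := fun i =>
  (p.s + e - 1 - i, ⟨(p.f (p.s + e - 1 - i)).toNat, by
    have := p.cases (p.s + e - 1 - i)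
    omega⟩)

theorem tuple_fst (p : Profile e ℓ) (i : Fin e) : (p.tuple i).1 = p.s + e - 1 - i := rfl

theorem tuple_snd (p : Profile e ℓ) (i : Fin e) :
    (((p.tuple i).2 : ℕ) : ℤ) = p.f (p.s + e - 1 - i) := by
  have := p.cases (p.s + e - 1 - i)
  change (((p.f (p.s + e - 1 - i)).toNat : ℕ) : ℤ) = _
  omega

theorem mem_range_tuple {p : Profile e ℓ} {c : ℤ} {x : Fin ℓ} :
    (c, x) ∈ Set.range p.tuple ↔ p.f c = (x : ℕ) := by
  constructor
  · rintro ⟨i, hi⟩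
    have h1 := p.tuple_snd i
    rw [← p.tuple_fst i, hi] at h1
    exact h1.symm
  · intro h
    have h1 := p.cases c
    have h2 := x.isLt
    refine ⟨⟨(p.s + e - 1 - c).toNat, by omega⟩, Prod.ext ?_ (Fin.ext ?_)⟩
    · rw [tuple_fst]
      simp only
      omega
    · zify
      rw [tuple_snd]
      simp only
      rw [← h]
      congr 1
      omega

theorem mem_range_tuple' {p : Profile e ℓ} {b : Pos ℓ} :
    b ∈ Set.range p.tuple ↔ p.f b.1 = (b.2 : ℕ) := mem_range_tuple

theorem exists_tuple_fst (p : Profile e ℓ) {c : ℤ} (h : p.s ≤ c) (h' : c < p.s + e) :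
    ∃ i, (p.tuple i).1 = c ∧ (((p.tuple i).2 : ℕ) : ℤ) = p.f c := by
  refine ⟨⟨(p.s + e - 1 - c).toNat, by omega⟩, ?_, ?_⟩
  · rw [tuple_fst]
    simp only
    omega
  · rw [tuple_snd]
    congr 1
    simp only
    omega

theorem tuple_injective (he : 0 < e) : Function.Injective (tuple : Profile e ℓ → _) := by
  intro p r h
  refine ext' he fun c => ?_
  have hs : p.s = r.s := by
    have := congrArg Prod.fst (congrFun h ⟨0, he⟩)
    simp only [tuple_fst] at this
    omega
  have h1 := p.cases c
  have h2 := r.cases c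
  rcases h1 with h1 | h1 | h1
  · omega
  · have := p.tuple_snd ⟨(p.s + e - 1 - c).toNat, by omega⟩
    rw [h, r.tuple_snd] at this
    simp only at this
    rw [show p.s + e - 1 - ((p.s + e - 1 - c).toNat : ℤ) = c by omega,
      show r.s + e - 1 - ((p.s + e - 1 - c).toNat : ℤ) = c by omega] at this
    exact this.symm
  · omega

theorem isQuasiperiod_tuple_iff {T : Set (Pos ℓ)} {p : Profile e ℓ} :
    IsQuasiperiod T p.tuple ↔ p.On (rowsOf T) := by
  constructor
  · intro h c h0 h1
    refine ⟨⟨(p.f c).toNat, by omega⟩, by simp only; omega, ?_⟩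
    have : (c, (⟨(p.f c).toNat, by omega⟩ : Fin ℓ)) ∈ Set.range p.tuple := by
      rw [mem_range_tuple]
      simp only
      omega
    obtain ⟨i, hi⟩ := this
    exact hi ▸ h.1 i
  · intro h
    refine ⟨fun i => ?_, fun i i' hi => ⟨?_, ?_⟩⟩
    · have h1 := p.tuple_snd i
      have h2 := (p.tuple i).2.isLt
      have h3 := h (p.s + e - 1 - i) (by omega) (by omega)
      rw [← h1] at h3
      exact rowsOf_coe.1 h3
    · rw [tuple_fst, tuple_fst, hi]
      push_cast
      ring
    · rw [Fin.le_def]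
      zify
      rw [tuple_snd, tuple_snd, hi]
      have := p.mono (p.s + e - 1 - ((i : ℕ) + 1 : ℕ))
      rwa [show p.s + e - 1 - (((i : ℕ) + 1 : ℕ) : ℤ) + 1 = p.s + e - 1 - (i : ℕ) by
        push_cast; ring] at this

theorem exists_tuple_eq (he : 0 < e) {T : Set (Pos ℓ)} {P : Fin e → Pos ℓ}
    (h : IsQuasiperiod T P) : ∃ p : Profile e ℓ, p.tuple = P := by
  have hcol : ∀ n (hn : n < e), (P ⟨n, hn⟩).1 = (P ⟨0, he⟩).1 - n := by
    intro n
    induction n with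
    | zero => intro _; simp
    | succ n ih =>
      intro hn
      have h1 := (h.2 ⟨n, by omega⟩ ⟨n + 1, hn⟩ rfl).1
      have h2 := ih (by omega)
      push_cast
      omega
  set β := (P ⟨0, he⟩).1 with hβ
  refine ⟨⟨fun c => if c < β - e + 1 then -1 else if hc : c ≤ β ∧ β - c < e then
    ((P ⟨(β - c).toNat, by omega⟩).2 : ℕ) else ℓ, β - e + 1, ?_, ?_, ?_, ?_⟩, ?_⟩
  · intro c
    split_ifs with h1 h2 h3 h4 h5 h6 h7
    all_goals try omega
    · have := (h.2 ⟨(β - (c + 1)).toNat, by omega⟩ ⟨(β - c).toNat, by omega⟩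
        (by simp only; omega)).2
      rw [Fin.le_def] at this
      exact_mod_cast this
  · intro c hc
    rw [if_pos hc]
  · intro c hc hc'
    rw [if_neg (by omega), dif_pos (by omega)]
    exact ⟨by positivity, by exact_mod_cast (P _).2.isLt⟩
  · intro c hc
    rw [if_neg (by omega), dif_neg (by omega)]
  · funext i
    have h0 := hcol i i.isLt
    refine Prod.ext ?_ (Fin.ext ?_)
    · rw [tuple_fst]
      simp only [Fin.eta] at h0 ⊢
      omega
    · zify
      rw [tuple_snd]
      have hi := i.isLt
      simp only
      rw [if_neg (by omega), dif_pos (by omega)]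
      congr 4
      refine Fin.ext ?_
      simp only
      omega

theorem tupleKey_injective : Function.Injective (tupleKey : (Fin e → Pos ℓ) → _) := by
  intro P P' h
  funext i
  have h1 : posKey (P i) = posKey (P' i) := congrFun h i
  have h2 := congrArg ofLex h1
  simp only [posKey, ofLex_toLex, Prod.mk.injEq] at h2
  exact Prod.ext h2.1 (OrderDual.toDual.injective h2.2)

/-- The lexicographic order extends the reversed pointwise order, so pointwise extrema are
lexicographic extrema. -/
theorem tupleKey_le (he : 0 < e) {p r : Profile e ℓ} (h : p ≤ r) :
    tupleKey r.tuple ≤ tupleKey p.tuple := by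
  rw [← not_lt]
  rintro ⟨i, -, hi⟩
  have hs := s_anti he h
  have hi' : posKey (p.tuple i) < posKey (r.tuple i) := hi
  rw [posKey, posKey, Prod.Lex.toLex_lt_toLex] at hi'
  simp only [tuple_fst] at hi'
  rcases hi' with h1 | ⟨h1, h2⟩
  · omega
  · rw [OrderDual.toDual_lt_toDual, Fin.lt_def] at h2
    zify at h2
    rw [tuple_snd, tuple_snd, h1] at h2
    have := h (r.s + e - 1 - i)
    omega

theorem tuple_shR (p : Profile e ℓ) : (fun i => shiftPos 1 (p.tuple i)) = p.shR.tuple := by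
  funext i
  refine Prod.ext ?_ (Fin.ext ?_)
  · simp only [shiftPos, tuple_fst, shR]
    ring
  · zify
    rw [tuple_snd, shR_f, shiftPos, tuple_snd]
    congr 1
    simp only [shR]
    ring

theorem tuple_shL (p : Profile e ℓ) : (fun i => shiftPos (-1) (p.tuple i)) = p.shL.tuple := by
  funext i
  refine Prod.ext ?_ (Fin.ext ?_)
  · simp only [shiftPos, tuple_fst, shL]
    ring
  · zify
    rw [tuple_snd, shL_f, shiftPos, tuple_snd]
    congr 1
    simp only [shL]
    ring

theorem disjoint_range_tuple {p r : Profile e ℓ} :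
    Disjoint (Set.range p.tuple) (Set.range r.tuple) ↔ p.Disj r := by
  rw [Set.disjoint_left]
  constructor
  · intro h c h1 h2 h3
    refine h (a := (c, ⟨(p.f c).toNat, by omega⟩)) ?_ ?_ <;> rw [mem_range_tuple] <;> simp only <;>
      omega
  · rintro h ⟨c, x⟩ h1 h2
    rw [mem_range_tuple] at h1 h2
    have := x.isLt
    exact h c (by omega) (by omega) (by omega)

end Profile

open Profile

/-! ### Fore periods, aft periods and shifts in terms of profiles -/

namespace Abacus
variable {ℓ : ℕ}

def rows (A : Abacus ℓ) : ℤ → ℤ → Prop := rowsOf A.beads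

theorem rows_coe {A : Abacus ℓ} {c : ℤ} {x : Fin ℓ} : A.rows c (x : ℕ) ↔ (c, x) ∈ A.beads :=
  rowsOf_coe

theorem rows_range {A : Abacus ℓ} {c v : ℤ} (h : A.rows c v) : 0 ≤ v ∧ v < ℓ := by
  obtain ⟨x, rfl, -⟩ := h
  have := x.isLt
  omega

theorem rows_injective {A B : Abacus ℓ} (h : ∀ c v, A.rows c v ↔ B.rows c v) : A = B := by
  apply Abacus.ext
  ext ⟨c, x⟩
  rw [← rows_coe, ← rows_coe]
  exact h _ _

theorem bounded (A : Abacus ℓ) : Bounded ℓ A.rows := by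
  obtain ⟨m, hm⟩ := A.full_left
  obtain ⟨M, hM⟩ := A.empty_right
  refine ⟨⟨m, fun c hc v h0 h1 => ⟨⟨v.toNat, by omega⟩, by simp only; omega, hm c hc _⟩⟩,
    M, fun c hc v ⟨x, _, hx⟩ => hM c hc x hx⟩

/-- The abacus with given rows. -/
def ofRows {S : ℤ → ℤ → Prop} (hS : Bounded ℓ S) : Abacus ℓ where
  beads := {b | S b.1 (b.2 : ℕ)}
  full_left := by
    obtain ⟨m, hm⟩ := hS.full
    exact ⟨m, fun c hc j => hm c hc _ (by positivity) (by exact_mod_cast j.isLt)⟩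
  empty_right := by
    obtain ⟨m, hm⟩ := hS.empty
    exact ⟨m, fun c hc j => hm c hc _⟩

theorem rows_ofRows {S : ℤ → ℤ → Prop} (hS : Bounded ℓ S) (h : ∀ c v, S c v → 0 ≤ v ∧ v < ℓ) :
    (ofRows hS).rows = S := by
  funext c v
  refine propext ⟨?_, fun hv => ?_⟩
  · rintro ⟨x, rfl, hx⟩
    exact hx
  · obtain ⟨h0, h1⟩ := h c v hv
    obtain ⟨n, rfl⟩ := Int.eq_ofNat_of_zero_le h0
    exact ⟨⟨n, by omega⟩, rfl, hv⟩

end Abacus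

variable {e ℓ : ℕ}

theorem isForeSeq_tuple (he : 0 < e) {A : Abacus ℓ} {p : ℕ → Profile e ℓ} (h : Fore A.rows p) :
    IsForeSeq A (fun k => (p k).tuple) := by
  intro k
  refine ⟨isQuasiperiod_tuple_iff.2 (h.on k), fun m hm => ⟨?_, ?_⟩, fun P hP hd => ?_⟩
  · refine lt_of_le_of_ne (tupleKey_le he (h.before_of_lt hm).1) fun heq => ?_
    have h1 := tuple_injective he (tupleKey_injective heq)
    have h2 := h.before_of_lt hm
    rw [h1] at h2
    exact not_before_self he _ h2
  · exact disjoint_range_tuple.2 (h.disj hm.ne')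
  · obtain ⟨r, rfl⟩ := exists_tuple_eq he hP
    exact tupleKey_le he (h.le_of_disj (isQuasiperiod_tuple_iff.1 hP) fun m hm =>
      (disjoint_range_tuple.1 (hd m hm).2).symm)

theorem IsForeSeq.unique {A : Abacus ℓ} {F F' : ℕ → Fin e → Pos ℓ} (h : IsForeSeq A F)
    (h' : IsForeSeq A F') : F = F' := by
  funext k
  induction k using Nat.strong_induction_on with
  | _ k ih =>
    refine tupleKey_injective (le_antisymm ?_ ?_)
    · exact (h' k).2.2 _ (h k).1 fun m hm => ih m hm ▸ (h k).2.1 m hm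
    · exact (h k).2.2 _ (h' k).1 fun m hm => ih m hm ▸ (h' k).2.1 m hm

theorem isForeSeq_iff (he : 0 < e) {A : Abacus ℓ} {p : ℕ → Profile e ℓ} (h : Fore A.rows p)
    {F : ℕ → Fin e → Pos ℓ} : IsForeSeq A F ↔ F = fun k => (p k).tuple :=
  ⟨fun hF => hF.unique (isForeSeq_tuple he h), fun hF => hF ▸ isForeSeq_tuple he h⟩

theorem isFore_iff (he : 0 < e) {A : Abacus ℓ} {p : ℕ → Profile e ℓ} (h : Fore A.rows p)
    {k : ℕ} {P : Fin e → Pos ℓ} : IsFore A k P ↔ P = (p k).tuple := by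
  simp only [IsFore, isForeSeq_iff he h, exists_eq_left]
  exact eq_comm

theorem isFree_iff {A : Abacus ℓ} {p : ℕ → Profile e ℓ} {b : Pos ℓ} :
    IsFree A (fun k => (p k).tuple) b ↔ Free A.rows p b.1 (b.2 : ℕ) := by
  refine and_congr Abacus.rows_coe.symm (forall_congr' fun m => ?_)
  rw [ne_eq, ← mem_range_tuple', Set.mem_range, not_exists]

theorem inVessel_bounds {A : Abacus ℓ} {p : ℕ → Profile e ℓ} (h : Fore A.rows p) {k : ℕ}
    {b : Pos ℓ} (hb : InVessel A (fun k => (p k).tuple) k b) :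
    With (Free A.rows p) (p k) b.1 (b.2 : ℕ) ∧ ((b.2 : ℕ) : ℤ) < (p (k + 1)).f b.1 := by
  have key : ∀ b : Pos ℓ, IsBetween (fun k => (p k).tuple) k b →
      ((b.2 : ℕ) : ℤ) < (p (k + 1)).f b.1 := by
    rintro b ⟨⟨i, hi⟩, -, -, h2⟩
    have h3 := (p (k + 1)).cases b.1
    have h4 := b.2.isLt
    rw [tuple_fst] at hi
    have h5 := i.isLt
    rcases h3 with h3 | h3 | h3
    · omega
    · obtain ⟨i', h6, h7⟩ := (p (k + 1)).exists_tuple_fst h3.1 h3.2.1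
      have h8 : b.2 < ((p (k + 1)).tuple i').2 := h2 i' h6
      rw [Fin.lt_def] at h8
      omega
    · omega
  cases hb with
  | fore i =>
    have h1 := (p k).tuple_snd i
    have h2 := (p k).tuple_fst i
    have h3 := ((p k).tuple i).2.isLt
    refine ⟨Or.inr ?_, ?_⟩
    · rw [h1, h2]
    · have h4 := (h.before k).1 ((p k).tuple i).1
      have h5 := (h.before k).2.ne_or ((p k).tuple i).1
      rw [h2] at *
      omega
  | beside _ h1 h2 h3 => exact ⟨Or.inl (isFree_iff.1 h1), key _ h2⟩
  | behind _ _ h1 h2 h3 h4 => exact ⟨Or.inl (isFree_iff.1 h1), key _ h2⟩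

/-- The delicate condition is the connectivity of the vessel behind `p k`. It holds because `r` has
beads in consecutive columns and reaches the columns of `p k`. -/
theorem inVessel_of_with {A : Abacus ℓ} {p : ℕ → Profile e ℓ} (he : 0 < e) (h : Fore A.rows p)
    {k : ℕ} {r : Profile e ℓ} (hr : r.On (With (Free A.rows p) (p k)))
    (hb : r.Before (p (k + 1))) : IsQuasiperiod {b | InVessel A (fun k => (p k).tuple) k b} r.tuple := by
  have hle := h.least k r hr
  have hs := s_anti he hle
  have hs' := s_anti he hb.1
  -- Otherwise `r` would lie entirely to the left of `p k` and consist of free beads.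
  have hov : (p k).s < r.s + e := by
    by_contra hcon
    refine h.not_on_free he A.bounded r fun c h0 h1 => ?_
    rcases hr c h0 h1 with h2 | h2
    · exact h2
    · have := r.cases c
      have := (p k).cases c
      omega
  have hbead : ∀ (c : ℤ) (x : Fin ℓ), r.f c = (x : ℕ) → (p k).f c ≠ (x : ℕ) →
      IsFree A (fun k => (p k).tuple) (c, x) ∧ IsBetween (fun k => (p k).tuple) k (c, x) := by
    intro c x hx hne
    have hx' := x.isLt
    have h1 := r.cases c
    have h2 := (p k).cases c
    refine ⟨isFree_iff.2 ?_, ⟨⟨e - 1, by omega⟩, ?_⟩, ⟨⟨0, he⟩, ?_⟩, fun i hi => ?_, fun i hi => ?_⟩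
    · have := (hr c (by omega) (by omega)).resolve_right (by omega)
      rwa [hx] at this
    · rw [tuple_fst]
      simp only
      omega
    · rw [tuple_fst]
      simp only
      omega
    · have h3 := (p k).tuple_snd i
      rw [← (p k).tuple_fst i, hi] at h3
      simp only at h3
      rw [Fin.lt_def]
      have := hle c
      simp only
      omega
    · have h3 := (p (k + 1)).tuple_snd i
      rw [← (p (k + 1)).tuple_fst i, hi] at h3
      simp only at h3
      rw [Fin.lt_def]
      have := hb.1 c
      have := hb.2.ne_or c
      simp only
      omega
  -- Induction on the distance to the first column of `p k`, following `r` to the right.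
  have key : ∀ n : ℕ, ∀ (c : ℤ) (x : Fin ℓ), (p k).s ≤ c + n → r.f c = (x : ℕ) →
      InVessel A (fun k => (p k).tuple) k (c, x) := by
    intro n
    induction n with
    | zero =>
      intro c x hc hx
      by_cases hp : (p k).f c = (x : ℕ)
      · obtain ⟨i, hi⟩ := mem_range_tuple.2 hp
        exact hi ▸ InVessel.fore i
      · obtain ⟨h1, h2⟩ := hbead c x hx hp
        refine InVessel.beside _ h1 h2 ⟨⟨e - 1, by omega⟩, ?_⟩
        rw [tuple_fst]
        simp only
        omega
    | succ n ih =>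
      intro c x hc hx
      by_cases hp : (p k).s ≤ c + n
      · exact ih c x hp hx
      have h3 := r.cases c
      have h4 := r.cases (c + 1)
      have hx' := x.isLt
      have h5 := (p k).cases c
      obtain ⟨h1, h2⟩ := hbead c x hx (by omega)
      refine InVessel.behind _ ⟨(r.f (c + 1)).toNat, by omega⟩ h1 h2 (fun i => ?_)
        (ih (c + 1) _ (by push_cast at hc; omega) (by simp only; omega))
      rw [tuple_fst]
      simp only
      have := i.isLt
      omega
  rw [isQuasiperiod_tuple_iff]
  intro c h0 h1
  exact ⟨⟨(r.f c).toNat, by omega⟩, by simp only; omega,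
    key ((p k).s - c).toNat c _ (by omega) (by simp only; omega)⟩

theorem isQuasiperiod_inVessel_iff {A : Abacus ℓ} {p : ℕ → Profile e ℓ} (he : 0 < e)
    (h : Fore A.rows p) {k : ℕ} {r : Profile e ℓ} :
    IsQuasiperiod {b | InVessel A (fun k => (p k).tuple) k b} r.tuple ↔
      r.On (With (Free A.rows p) (p k)) ∧ r.Before (p (k + 1)) := by
  refine ⟨fun hr => ?_, fun hr => inVessel_of_with he h hr.1 hr.2⟩
  rw [isQuasiperiod_tuple_iff] at hr
  have hb : ∀ c, 0 ≤ r.f c → r.f c < ℓ →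
      With (Free A.rows p) (p k) c (r.f c) ∧ r.f c < (p (k + 1)).f c := by
    intro c h0 h1
    obtain ⟨x, hx, hx'⟩ := hr c h0 h1
    rw [← hx]
    exact inVessel_bounds h hx'
  refine ⟨fun c h0 h1 => (hb c h0 h1).1, fun c => ?_, fun c h1 h2 h3 => ?_⟩
  · have h1 := r.cases c
    have h2 := (p (k + 1)).cases c
    have h3 := hb c
    have h4 := r.cases r.s
    have h5 := (hb r.s (by omega) (by omega)).2
    have h6 := (p (k + 1)).cases r.s
    omega
  · have := (hb c h2 h3).2
    omega

theorem isAft_iff (he : 0 < e) {A : Abacus ℓ} {p : ℕ → Profile e ℓ} (h : Fore A.rows p) {k : ℕ}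
    {Q : Fin e → Pos ℓ} : IsAft A k Q ↔ ∃ q, Aft A.rows p k q ∧ q.tuple = Q := by
  simp only [IsAft, isForeSeq_iff he h, exists_eq_left]
  constructor
  · rintro ⟨hQ, hmin⟩
    obtain ⟨q, rfl⟩ := exists_tuple_eq he hQ
    obtain ⟨q', hq'⟩ := h.exists_aft he k
    have h1 := (isQuasiperiod_inVessel_iff he h).1 hQ
    have h2 := hmin _ ((isQuasiperiod_inVessel_iff he h).2 ⟨hq'.on, hq'.before⟩)
    have h3 := tupleKey_le he (hq'.greatest q h1.1 h1.2)
    exact ⟨q', hq', tupleKey_injective (le_antisymm h3 h2)⟩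
  · rintro ⟨q, hq, rfl⟩
    refine ⟨(isQuasiperiod_inVessel_iff he h).2 ⟨hq.on, hq.before⟩, fun P hP => ?_⟩
    obtain ⟨r, rfl⟩ := exists_tuple_eq he hP
    have h1 := (isQuasiperiod_inVessel_iff he h).1 hP
    exact tupleKey_le he (hq.greatest r h1.1 h1.2)

theorem shifts_iff {A B : Abacus ℓ} {p p' : Profile e ℓ} {d : ℤ}
    (hd : (fun i => shiftPos d (p.tuple i)) = p'.tuple) :
    Shifts d A p.tuple B ↔ (∀ c v, A.rows c v → p'.f c = v → p.f c = v) ∧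
      ∀ c v, B.rows c v ↔ swap A.rows p p' c v := by
  unfold Shifts
  rw [hd]
  have hd' : ∀ i, shiftPos d (p.tuple i) = p'.tuple i := fun i => congrFun hd i
  refine and_congr ⟨fun h c v hv hp => ?_, fun h i hi hA => ?_⟩ ⟨fun h c v => ?_, fun h => ?_⟩
  · obtain ⟨x, rfl, hx⟩ := hv
    obtain ⟨i, hi⟩ := mem_range_tuple.2 hp
    by_contra hne
    refine h i ?_ ?_
    · rw [hd', hi, mem_range_tuple]
      exact hne
    · rwa [hd', hi]
  · rw [hd'] at hi hA
    have h1 : p'.tuple i ∈ Set.range p'.tuple := ⟨i, rfl⟩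
    rw [mem_range_tuple'] at hi h1
    exact hi (h _ _ (Abacus.rows_coe.2 hA) h1)
  · constructor
    · rintro ⟨x, rfl, hx⟩
      rw [h] at hx
      rcases hx with ⟨h1, h2⟩ | h1
      · rw [mem_range_tuple] at h2
        exact Or.inl ⟨Abacus.rows_coe.2 h1, h2⟩
      · exact Or.inr ⟨mem_range_tuple.1 h1, by positivity, by exact_mod_cast x.isLt⟩
    · intro hv
      have hr : 0 ≤ v ∧ v < ℓ := by
        rcases hv with hv | hv
        · exact Abacus.rows_range hv.1
        · exact hv.2
      obtain ⟨n, rfl⟩ := Int.eq_ofNat_of_zero_le hr.1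
      refine ⟨⟨n, by omega⟩, rfl, ?_⟩
      rw [h]
      rcases hv with hv | hv
      · refine Or.inl ⟨Abacus.rows_coe.1 hv.1, ?_⟩
        rw [mem_range_tuple]
        exact hv.2
      · exact Or.inr (mem_range_tuple.2 hv.1)
  · ext ⟨c, x⟩
    rw [← Abacus.rows_coe, h]
    refine or_congr (and_congr Abacus.rows_coe ?_) ?_
    · rw [ne_eq, ← mem_range_tuple]
    · rw [← mem_range_tuple]
      exact and_iff_left ⟨by positivity, by exact_mod_cast x.isLt⟩

end SlInfty

namespace SlInfty
open Profile
variable {e ℓ : ℕ}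

/-! ### Shifts of fore and aft periods -/

theorem exists_rows_swap (A : Abacus ℓ) (q q' : Profile e ℓ) :
    ∃ B : Abacus ℓ, B.rows = swap A.rows q q' := by
  refine ⟨Abacus.ofRows (A.bounded.swap q q'), ?_⟩
  rw [Abacus.rows_ofRows]
  rintro c v (h | h)
  · exact Abacus.rows_range h.1
  · exact h.2

theorem addsGoodStrip_iff (he : 0 < e) {A B : Abacus ℓ} {p : ℕ → Profile e ℓ}
    (h : Fore A.rows p) {k : ℕ} : AddsGoodStrip e k A B ↔
      (∀ c v, A.rows c v → (p k).shR.f c = v → (p k).f c = v) ∧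
        B.rows = swap A.rows (p k) (p k).shR := by
  simp only [AddsGoodStrip, isFore_iff he h, exists_eq_left, shifts_iff (tuple_shR (p k))]
  simp only [funext_iff, eq_iff_iff]

theorem travelsUpstream_iff (he : 0 < e) {A B : Abacus ℓ} {p p' : ℕ → Profile e ℓ}
    (h : Fore A.rows p) (h' : Fore B.rows p') {k : ℕ} : TravelsUpstream e k A B ↔
      ∃ q, Aft A.rows p k q ∧ (∀ c v, A.rows c v → q.shL.f c = v → q.f c = v) ∧
        B.rows = swap A.rows q q.shL ∧ p' k = q.shL := by
  simp only [TravelsUpstream, isAft_iff he h, isFore_iff he h']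
  constructor
  · rintro ⟨_, ⟨q, hq, rfl⟩, h1, h2⟩
    rw [shifts_iff (tuple_shL q)] at h1
    rw [tuple_shL] at h2
    exact ⟨q, hq, h1.1, by simpa only [funext_iff, eq_iff_iff] using h1.2,
      (tuple_injective he h2).symm⟩
  · rintro ⟨q, hq, h1, h2, h3⟩
    refine ⟨_, ⟨q, hq, rfl⟩, (shifts_iff (tuple_shL q)).2 ⟨h1, fun c v => by rw [h2]⟩, ?_⟩
    rw [tuple_shL, h3]

theorem AddsGoodStrip.unique (he : 0 < e) (hℓ : 0 < ℓ) {A B B' : Abacus ℓ} {k : ℕ}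
    (h : AddsGoodStrip e k A B) (h' : AddsGoodStrip e k A B') : B = B' := by
  obtain ⟨p, hp⟩ := exists_fore he hℓ A.bounded
  rw [addsGoodStrip_iff he hp] at h h'
  exact Abacus.rows_injective fun c v => by rw [h.2, h'.2]

/-- The shift of the aft period is a fore period of `B`; shifting it back restores `A`. -/
theorem TravelsUpstream.addsGoodStrip (he : 0 < e) (hℓ : 0 < ℓ) {A B : Abacus ℓ} {k : ℕ}
    (h : TravelsUpstream e k A B) : AddsGoodStrip e k B A := by
  obtain ⟨p, hp⟩ := exists_fore he hℓ A.bounded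
  obtain ⟨p', hp'⟩ := exists_fore he hℓ B.bounded
  obtain ⟨q, hq, h1, h2, h3⟩ := (travelsUpstream_iff he hp hp').1 h
  have hqA : q.On A.rows := hq.on.mono fun c v h4 h5 h6 h7 => by
    rcases h7 with h7 | h7
    · exact h7.1
    · rw [← h7]
      exact hp.on k c (by omega) (by omega)
  rw [addsGoodStrip_iff he hp', h3, shR_shL he]
  constructor
  · intro c v h4 h5
    rw [h2] at h4
    rcases h4 with h4 | h4
    · exact absurd h5 h4.2
    · exact h4.1
  · funext c v
    rw [h2]
    refine propext ⟨fun h4 => ?_, ?_⟩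
    · by_cases h5 : q.f c = v
      · exact Or.inr ⟨h5, Abacus.rows_range h4⟩
      · exact Or.inl ⟨Or.inl ⟨h4, h5⟩, fun h6 => h5 (h1 c v h4 h6)⟩
    · rintro (⟨h4 | h4, h5⟩ | h4)
      · exact h4.1
      · exact absurd h4.1 h5
      · rw [← h4.1]
        exact hqA c (by omega) (by omega)

theorem TravelsUpstream.unique (he : 0 < e) (hℓ : 0 < ℓ) {A B B' : Abacus ℓ} {k : ℕ}
    (h : TravelsUpstream e k A B) (h' : TravelsUpstream e k A B') : B = B' := by
  obtain ⟨p, hp⟩ := exists_fore he hℓ A.bounded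
  obtain ⟨r, hr⟩ := exists_fore he hℓ B.bounded
  obtain ⟨r', hr'⟩ := exists_fore he hℓ B'.bounded
  obtain ⟨q, hq, -, h2, -⟩ := (travelsUpstream_iff he hp hr).1 h
  obtain ⟨q', hq', -, h2', -⟩ := (travelsUpstream_iff he hp hr').1 h'
  exact Abacus.rows_injective fun c v => by rw [h2, h2', hq.unique he hq']

/-- The aft period with index `k` can travel upstream. -/
def Loose (e : ℕ) {ℓ : ℕ} (k : ℕ) (A : Abacus ℓ) : Prop := ∃ B, TravelsUpstream e k A B

theorem TravelsUpstream.before (he : 0 < e) {A B : Abacus ℓ} {k : ℕ} {p : ℕ → Profile e ℓ}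
    (hℓ : 0 < ℓ) (hp : Fore A.rows p) (h : TravelsUpstream e k A B) :
    (p k).Before (p (k + 1)).shR := by
  obtain ⟨p', hp'⟩ := exists_fore he hℓ B.bounded
  obtain ⟨q, hq, h1, h2, h3⟩ := (travelsUpstream_iff he hp hp').1 h
  refine hp.before_of_shiftLeft he hq (fun c _ _ h4 => ?_) (h2 ▸ hp') h3
  exact h1 c _ h4 rfl

theorem TravelsUpstream.exists_update (he : 0 < e) (hℓ : 0 < ℓ) {A B : Abacus ℓ} {k : ℕ}
    {p : ℕ → Profile e ℓ} (hp : Fore A.rows p) (h : TravelsUpstream e k A B) :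
    ∃ q, Aft A.rows p k q ∧ Fore B.rows (Function.update p k q.shL) := by
  have hb := h.before he hℓ hp
  obtain ⟨p', hp'⟩ := exists_fore he hℓ B.bounded
  obtain ⟨q, hq, h1, h2, h3⟩ := (travelsUpstream_iff he hp hp').1 h
  exact ⟨q, hq, h2 ▸ hp.shiftLeft he A.bounded hq (hp.aft_before he hq hb)⟩

theorem loose_iff (he : 0 < e) (hℓ : 0 < ℓ) {A : Abacus ℓ} {p : ℕ → Profile e ℓ}
    (hp : Fore A.rows p) {k : ℕ} : Loose e k A ↔ (p k).Before (p (k + 1)).shR := by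
  refine ⟨fun ⟨B, h⟩ => h.before he hℓ hp, fun hb => ?_⟩
  obtain ⟨q, hq⟩ := hp.exists_aft he k
  have hqb := hp.aft_before he hq hb
  obtain ⟨B, hB'⟩ := exists_rows_swap A q q.shL
  refine ⟨B, (travelsUpstream_iff he hp (hB' ▸ hp.shiftLeft he A.bounded hq hqb)).2
    ⟨q, hq, fun c v h1 h2 => ?_, hB', Function.update_self ..⟩⟩
  by_contra hne
  have h3 := Abacus.rows_range h1
  have h4 := hp.wall_aft he hq hqb h3.1 h3.2 h1 hne
  have h5 := q.mono c
  rw [shL_f] at h2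
  omega

theorem TravelsUpstream.loose_iff (he : 0 < e) (hℓ : 0 < ℓ) {A B : Abacus ℓ} {k m : ℕ}
    (h : TravelsUpstream e k A B) (hm : m ≠ k) (hm' : m + 1 ≠ k) : Loose e m A ↔ Loose e m B := by
  obtain ⟨p, hp⟩ := exists_fore he hℓ A.bounded
  obtain ⟨q, hq, hB⟩ := h.exists_update he hℓ hp
  rw [SlInfty.loose_iff he hℓ hp, SlInfty.loose_iff he hℓ hB, Function.update_of_ne hm,
    Function.update_of_ne hm']

/-- The new fore period with index `k + 1` is `q.shL`, whose right shift is `q`, and `p k` lies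
before `q` because `p (k + 1) ≤ q`. -/
theorem TravelsUpstream.loose (he : 0 < e) (hℓ : 0 < ℓ) {A B : Abacus ℓ} {k : ℕ}
    (h : TravelsUpstream e (k + 1) A B) : Loose e k B := by
  obtain ⟨p, hp⟩ := exists_fore he hℓ A.bounded
  obtain ⟨q, hq, hB⟩ := h.exists_update he hℓ hp
  rw [SlInfty.loose_iff he hℓ hB, Function.update_self, Function.update_of_ne (by omega), shR_shL he]
  exact (hp.before k).of_le (Profile.le_refl _) (hq.le hp)

/-- Partial converse of `TravelsUpstream.addsGoodStrip`: looseness at the preceding index is what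
`Fore.shiftRight` needs; there is no condition for `k = 0`. -/
theorem exists_travelsUpstream (he : 0 < e) (hℓ : 0 < ℓ) {A : Abacus ℓ} {k : ℕ}
    (h : ∀ m, m + 1 = k → Loose e m A) : ∃ B, TravelsUpstream e k B A := by
  obtain ⟨p, hp⟩ := exists_fore he hℓ A.bounded
  have hk : ∀ m < k, (p m).Before (p k).shR := by
    intro m hm
    obtain ⟨n, rfl⟩ : ∃ n, k = n + 1 := ⟨k - 1, by omega⟩
    exact ((loose_iff he hℓ hp).1 (h n rfl)).of_le (hp.le_of_le (by omega)) (Profile.le_refl _)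
  obtain ⟨p', hp', hq⟩ := hp.shiftRight he A.bounded hk
  obtain ⟨B, hB'⟩ := exists_rows_swap A (p k) (p k).shR
  have hw : ∀ c v, A.rows c v → (p k).shR.f c = v → (p k).f c = v := by
    intro c v h1 h2
    by_contra hne
    have h3 := Abacus.rows_range h1
    have h4 := hp.wall he hk h3.1 h3.2 h1 hne
    have h5 := (p k).mono' c
    rw [shR_f] at h2
    omega
  rw [← hB'] at hp' hq
  refine ⟨B, (travelsUpstream_iff he hp' hp).2 ⟨_, hq, ?_, ?_, (shL_shR he _).symm⟩⟩
  · rw [shL_shR he]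
    intro c v h1 h2
    rw [hB'] at h1
    rcases h1 with h1 | h1
    · exact absurd h2 h1.2
    · exact h1.1
  · rw [shL_shR he]
    funext c v
    rw [hB']
    refine propext ⟨fun h4 => ?_, ?_⟩
    · by_cases h5 : (p k).f c = v
      · exact Or.inr ⟨h5, Abacus.rows_range h4⟩
      · exact Or.inl ⟨Or.inl ⟨h4, h5⟩, fun h6 => h5 (hw c v h4 h6)⟩
    · rintro (⟨h4 | h4, h5⟩ | h4)
      · exact h4.1
      · exact absurd h4.1 h5
      · rw [← h4.1]
        exact hp.on k c (by omega) (by omega)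

theorem TravelsUpstream.fore_eq (he : 0 < e) (hℓ : 0 < ℓ) {A B : Abacus ℓ} {k m : ℕ}
    {p r : ℕ → Profile e ℓ} (hp : Fore A.rows p) (hr : Fore B.rows r)
    (h : TravelsUpstream e k A B) (hm : m ≠ k) : r m = p m := by
  obtain ⟨q, hq, hB⟩ := h.exists_update he hℓ hp
  rw [hr.unique he hB, Function.update_of_ne hm]

/-- Shifts of different fore periods commute. -/
theorem TravelsUpstream.comm (he : 0 < e) (hℓ : 0 < ℓ) {k m : ℕ} (hkm : k ≠ m)
    {X Y X' Y' Y'' : Abacus ℓ} (h1 : TravelsUpstream e k Y X) (h2 : TravelsUpstream e m X' X)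
    (h3 : TravelsUpstream e m Y' Y) (h4 : TravelsUpstream e k Y'' X') : Y' = Y'' := by
  obtain ⟨x, hx⟩ := exists_fore he hℓ X.bounded
  obtain ⟨y, hy⟩ := exists_fore he hℓ Y.bounded
  obtain ⟨x', hx'⟩ := exists_fore he hℓ X'.bounded
  have a1 := (addsGoodStrip_iff he hx).1 (h1.addsGoodStrip he hℓ)
  have a2 := (addsGoodStrip_iff he hx).1 (h2.addsGoodStrip he hℓ)
  have a3 := (addsGoodStrip_iff he hy).1 (h3.addsGoodStrip he hℓ)
  have a4 := (addsGoodStrip_iff he hx').1 (h4.addsGoodStrip he hℓ)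
  rw [← h1.fore_eq he hℓ hy hx hkm.symm] at a3
  rw [← h2.fore_eq he hℓ hx' hx hkm] at a4
  refine Abacus.rows_injective fun c v => ?_
  rw [a3.2, a4.2]
  unfold swap
  rw [a1.2, a2.2]
  unfold swap
  have b1 : (x k).f c = v → (x m).f c = v → ¬ (0 ≤ v ∧ v < ℓ) := fun i1 i2 i3 =>
    hx.disj hkm c (i1.trans i2.symm) (by omega) (by omega)
  -- A bead of `x m` met by the shift of `x k` is a bead of `X`, hence, the shift being legal, a
  -- bead of `x k`; but `x k` and `x m` are disjoint.
  have b2 : (x k).shR.f c = v → (x m).f c = v → ¬ (0 ≤ v ∧ v < ℓ) := fun i1 i2 i3 => by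
    have := hx.on m c (by omega) (by omega)
    rw [i2] at this
    exact b1 (a1.1 c v this i1) i2 i3
  have b3 : (x m).shR.f c = v → (x k).f c = v → ¬ (0 ≤ v ∧ v < ℓ) := fun i1 i2 i3 => by
    have := hx.on k c (by omega) (by omega)
    rw [i2] at this
    exact b1 i2 (a2.1 c v this i1) i3
  have aux : ∀ T K K' M M' R : Prop, (K' → M → ¬ R) → (M' → K → ¬ R) →
      (((T ∧ ¬ K ∨ K' ∧ R) ∧ ¬ M ∨ M' ∧ R) ↔ ((T ∧ ¬ M ∨ M' ∧ R) ∧ ¬ K ∨ K' ∧ R)) := by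
    grind
  exact aux _ _ _ _ _ _ b2 b3

/-- If the aft period with index `k` travels upstream `n` times, the fore periods with this index
increase below the next fore period. -/
theorem steps_travelsUpstream_bound (he : 0 < e) (hℓ : 0 < ℓ) (k : ℕ) (A : Abacus ℓ) :
    ∃ N, ∀ n B, Steps (TravelsUpstream e k) n A B → n ≤ N := by
  obtain ⟨p, hp⟩ := exists_fore he hℓ A.bounded
  have key : ∀ (n : ℕ) (B C : Abacus ℓ) (r : ℕ → Profile e ℓ), Fore B.rows r → p k ≤ r k →
      r (k + 1) = p (k + 1) → Steps (TravelsUpstream e k) n B C →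
      ∑ c ∈ Finset.Ico (p (k + 1)).s ((p k).s + e), (r k).f c + n ≤
        ((p k).s + e - (p (k + 1)).s).toNat * ℓ := by
    intro n
    induction n with
    | zero =>
      intro B C r _ _ _ _
      have := (r k).sum_le_bound (p (k + 1)).s ((p k).s + e)
      simpa using this
    | succ n ih =>
      rintro B C r hr hle hk ⟨B', h1, h2⟩
      obtain ⟨q, hq, hB⟩ := h1.exists_update he hℓ hr
      have hlq := hq.le hr
      have hle' : r k ≤ q.shL := Profile.le_trans hlq q.le_shL
      have h3 := ih B' C _ hB (by rw [Function.update_self]; exact Profile.le_trans hle hle')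
        (by rw [Function.update_of_ne (by omega), hk]) h2
      rw [Function.update_self] at h3
      have h4 := hB.before k
      rw [Function.update_self, Function.update_of_ne (by omega), hk] at h4
      -- The shift gains the column `q.s - 1`, in which neither `q` nor `r k` has a bead, so the
      -- column sum strictly increases.
      have h5 : (r k).f (q.s - 1) < q.shL.f (q.s - 1) := by
        rw [shL_f, sub_add_cancel]
        have i1 := q.cases q.s
        have i2 := q.cases (q.s - 1)
        have i3 := hlq (q.s - 1)
        omega
      have h6 := sum_lt_sum he hle' (s_anti he h4.1) (b := (p k).s + e)
        (by have := s_anti he hle; omega) h5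
      push_cast
      omega
  refine ⟨(((p k).s + e - (p (k + 1)).s).toNat * ℓ + ((p k).s + e - (p (k + 1)).s).toNat), 
    fun n B h => ?_⟩
  have h1 := key n A B p hp (Profile.le_refl _) rfl h
  have h2 := (p k).sum_nonneg_bound (p (k + 1)).s ((p k).s + e)
  zify
  omega

theorem exists_not_loose (he : 0 < e) (hℓ : 0 < ℓ) (A : Abacus ℓ) :
    ∃ K, ∀ k, K ≤ k → ¬ Loose e k A := by
  obtain ⟨p, hp⟩ := exists_fore he hℓ A.bounded
  obtain ⟨K, hK⟩ := hp.exists_not_before_shR he A.bounded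
  exact ⟨K, fun k hk => by rw [loose_iff he hℓ hp]; exact hK k hk⟩

end SlInfty

namespace SlInfty
variable {e ℓ : ℕ}

/-! ### Iterated steps -/

theorem Steps.unique {X : Type*} {R : X → X → Prop} (hR : ∀ a b b', R a b → R a b' → b = b')
    {n : ℕ} {a b b' : X} (h : Steps R n a b) (h' : Steps R n a b') : b = b' := by
  induction n generalizing a with
  | zero => exact (show a = b from h).symm.trans h'
  | succ n ih =>
    obtain ⟨c, h1, h2⟩ := h
    obtain ⟨c', h1', h2'⟩ := h'
    obtain rfl := hR _ _ _ h1 h1'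
    exact ih h2 h2'

/-! ### Gaps -/

/-- The number of successive times that the aft period with index `k` can travel upstream. -/
noncomputable def gap (e : ℕ) {ℓ : ℕ} (k : ℕ) (A : Abacus ℓ) : ℕ :=
  sSup {q | ∃ B, Steps (TravelsUpstream e k) q A B}

theorem isGreatest_gap (he : 0 < e) (hℓ : 0 < ℓ) (k : ℕ) (A : Abacus ℓ) :
    IsGreatest {q | ∃ B, Steps (TravelsUpstream e k) q A B} (gap e k A) := by
  obtain ⟨N, hN⟩ := steps_travelsUpstream_bound he hℓ k A
  have hb : BddAbove {q | ∃ B, Steps (TravelsUpstream e k) q A B} := ⟨N, fun n ⟨B, h⟩ => hN n B h⟩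
  exact ⟨Nat.sSup_mem ⟨0, A, rfl⟩ hb, fun n hn => le_csSup hb hn⟩

theorem TravelsUpstream.gap_eq (he : 0 < e) (hℓ : 0 < ℓ) {A B : Abacus ℓ} {k : ℕ}
    (h : TravelsUpstream e k A B) : gap e k A = gap e k B + 1 := by
  refine (isGreatest_gap he hℓ k A).unique ⟨?_, ?_⟩
  · obtain ⟨C, hC⟩ := (isGreatest_gap he hℓ k B).1
    exact ⟨C, B, h, hC⟩
  · rintro (_ | n) ⟨C, hC⟩
    · omega
    · obtain ⟨B', h1, h2⟩ := hC
      obtain rfl := h.unique he hℓ h1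
      exact Nat.succ_le_succ ((isGreatest_gap he hℓ k B).2 ⟨C, h2⟩)

theorem gap_eq_zero_iff (he : 0 < e) (hℓ : 0 < ℓ) {A : Abacus ℓ} {k : ℕ} :
    gap e k A = 0 ↔ ¬ Loose e k A := by
  constructor
  · rintro h ⟨B, hB⟩
    have := hB.gap_eq he hℓ
    omega
  · intro h
    obtain ⟨C, hC⟩ := (isGreatest_gap he hℓ k A).1
    by_contra hne
    obtain ⟨n, hn⟩ := Nat.exists_eq_succ_of_ne_zero hne
    rw [hn] at hC
    obtain ⟨B, h1, -⟩ := hC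
    exact h ⟨B, h1⟩

theorem loose_iff_gap (he : 0 < e) (hℓ : 0 < ℓ) {A : Abacus ℓ} {k : ℕ} :
    Loose e k A ↔ 0 < gap e k A := by
  rw [Nat.pos_iff_ne_zero, ne_eq, gap_eq_zero_iff he hℓ, not_not]

theorem TravelsUpstream.diamond (he : 0 < e) (hℓ : 0 < ℓ) {A B C : Abacus ℓ} {k m : ℕ}
    (hB : TravelsUpstream e k A B) (hC : TravelsUpstream e m A C) (hm : m ≠ k) (hm' : m + 1 ≠ k) :
    ∃ D, TravelsUpstream e m B D ∧ TravelsUpstream e k C D := by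
  -- The square is closed from its bottom corner: from `D` both shifts are undone in the other
  -- order, and commutation identifies the top with `A`.
  obtain ⟨D, hD⟩ := (hB.loose_iff he hℓ hm hm').1 ⟨C, hC⟩
  obtain ⟨C', hC'⟩ := exists_travelsUpstream he hℓ (A := D) (k := k) (by
    rintro i rfl
    exact (hD.loose_iff he hℓ (by omega) (by omega)).1 (hB.loose he hℓ))
  obtain ⟨A', hA'⟩ := exists_travelsUpstream he hℓ (A := C') (k := m) (by
    rintro i rfl
    by_cases hik : i = k
    · subst hik
      exact ⟨D, hC'⟩
    · exact (hC'.loose_iff he hℓ hik (by omega)).2 (hD.loose he hℓ))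
  obtain rfl := hC'.comm he hℓ hm.symm hD hA' hB
  obtain rfl := hC.unique he hℓ hA'
  exact ⟨D, hD, hC'⟩

theorem TravelsUpstream.gap_eq_of_ne (he : 0 < e) (hℓ : 0 < ℓ) {A B : Abacus ℓ} {k m : ℕ}
    (h : TravelsUpstream e k A B) (hm : m ≠ k) (hm' : m + 1 ≠ k) : gap e m A = gap e m B := by
  induction hn : gap e m A generalizing A B with
  | zero =>
    rw [gap_eq_zero_iff he hℓ, h.loose_iff he hℓ hm hm', ← gap_eq_zero_iff he hℓ] at hn
    exact hn.symm
  | succ n ih =>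
    obtain ⟨C, hC⟩ := (loose_iff_gap he hℓ).2 (show 0 < gap e m A by omega)
    obtain ⟨D, h1, h2⟩ := h.diamond he hℓ hC hm hm'
    rw [h1.gap_eq he hℓ, ← ih h2 (by have := hC.gap_eq he hℓ; omega)]

/-- The gap becomes positive by `TravelsUpstream.loose`. If it rose from zero to two or more,
undoing the travels in the other order would reach `A` from below with index `k` loose. The general
case reduces to this one by diamonds. -/
theorem TravelsUpstream.gap_eq_of_succ (he : 0 < e) (hℓ : 0 < ℓ) {A B : Abacus ℓ} {k : ℕ}
    (h : TravelsUpstream e (k + 1) A B) : gap e k B = gap e k A + 1 := by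
  induction hn : gap e k A generalizing A B with
  | zero =>
    obtain ⟨C, hC⟩ := h.loose he hℓ
    rw [hC.gap_eq he hℓ, (gap_eq_zero_iff he hℓ).2]
    intro hL
    obtain ⟨D, hD⟩ := exists_travelsUpstream he hℓ (A := C) (k := k + 1) (by
      intro i hi
      obtain rfl : i = k := by omega
      exact hL)
    obtain ⟨A', hA'⟩ := exists_travelsUpstream he hℓ (A := D) (k := k) (by
      rintro i rfl
      exact (hD.loose_iff he hℓ (by omega) (by omega)).2 (hC.loose he hℓ))
    obtain rfl := hD.comm he hℓ (by omega) hC hA' h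
    exact (gap_eq_zero_iff he hℓ).1 hn ⟨D, hA'⟩
  | succ n ih =>
    obtain ⟨C, hC⟩ := (loose_iff_gap he hℓ).2 (show 0 < gap e k A by omega)
    obtain ⟨D, h1, h2⟩ := hC.diamond he hℓ h (by omega) (by omega)
    rw [h2.gap_eq he hℓ, ih h1 (by have := hC.gap_eq he hℓ; omega)]

theorem TravelsUpstream.gap_add (he : 0 < e) (hℓ : 0 < ℓ) {A B : Abacus ℓ} {k : ℕ}
    (h : TravelsUpstream e k A B) (i : ℕ) :
    gap e i A + (if i + 1 = k then 1 else 0) = gap e i B + (if i = k then 1 else 0) := by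
  by_cases h1 : i = k
  · subst h1
    have := h.gap_eq he hℓ
    rw [if_neg (by omega), if_pos rfl]
    omega
  by_cases h2 : i + 1 = k
  · subst h2
    have := h.gap_eq_of_succ he hℓ
    rw [if_pos rfl, if_neg (by omega)]
    omega
  · rw [if_neg h1, if_neg h2, h.gap_eq_of_ne he hℓ h1 h2]

/-! ### Descents -/

/-- Some aft period of `A` can travel upstream, giving `B`. -/
def Descends (e : ℕ) {ℓ : ℕ} (A B : Abacus ℓ) : Prop := ∃ k, TravelsUpstream e k A B

theorem Descends.confluent (he : 0 < e) (hℓ : 0 < ℓ) (A B C : Abacus ℓ) (hB : Descends e A B)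
    (hC : Descends e A C) :
    ∃ D, Relation.ReflGen (Descends e) B D ∧ Relation.ReflTransGen (Descends e) C D := by
  obtain ⟨k, hB⟩ := hB
  obtain ⟨m, hC⟩ := hC
  by_cases hkm : m = k
  · subst hkm
    obtain rfl := hB.unique he hℓ hC
    exact ⟨B, .refl, .refl⟩
  -- The hypothesis of `diamond` is not symmetric in `k` and `m`; for `m + 1 = k` the roles are
  -- exchanged.
  by_cases hm : m + 1 = k
  · obtain ⟨D, h1, h2⟩ := hC.diamond he hℓ hB (Ne.symm hkm) (by omega)
    exact ⟨D, .single ⟨m, h2⟩, .single ⟨k, h1⟩⟩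
  · obtain ⟨D, h1, h2⟩ := hB.diamond he hℓ hC hkm hm
    exact ⟨D, .single ⟨m, h1⟩, .single ⟨k, h2⟩⟩

/-- No aft period of `A` can travel upstream. -/
def Packed (e : ℕ) {ℓ : ℕ} (A : Abacus ℓ) : Prop := ∀ k, gap e k A = 0

theorem Packed.eq_of_descends (he : 0 < e) (hℓ : 0 < ℓ) {A B : Abacus ℓ} (hA : Packed e A)
    (h : Relation.ReflTransGen (Descends e) A B) : B = A := by
  rcases Relation.ReflTransGen.cases_head h with h1 | ⟨C, ⟨k, h1⟩, -⟩
  · exact h1.symm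
  · have := h1.gap_eq he hℓ
    have := hA k
    omega

theorem Packed.unique_of_join (he : 0 < e) (hℓ : 0 < ℓ) {A B : Abacus ℓ} (hA : Packed e A)
    (hB : Packed e B) (h : Relation.Join (Relation.ReflTransGen (Descends e)) A B) : A = B := by
  obtain ⟨C, h1, h2⟩ := h
  rw [← hA.eq_of_descends he hℓ h1, hB.eq_of_descends he hℓ h2]

theorem Packed.unique (he : 0 < e) (hℓ : 0 < ℓ) {A B C : Abacus ℓ} (hB : Packed e B)
    (hC : Packed e C) (h : Relation.ReflTransGen (Descends e) A B)
    (h' : Relation.ReflTransGen (Descends e) A C) : B = C :=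
  hB.unique_of_join he hℓ hC (Relation.church_rosser (Descends.confluent he hℓ) h h')

/-- The number of descents from an abacus whose gaps with index at least `K` vanish. -/
noncomputable def height (e K : ℕ) {ℓ : ℕ} (A : Abacus ℓ) : ℕ :=
  ∑ i ∈ Finset.range K, (i + 1) * gap e i A

theorem TravelsUpstream.gap_bound (he : 0 < e) (hℓ : 0 < ℓ) {A B : Abacus ℓ} {k K : ℕ}
    (h : TravelsUpstream e k A B) (hK : ∀ i, K ≤ i → gap e i A = 0) :
    (∀ i, K ≤ i → gap e i B = 0) ∧ height e K A = height e K B + 1 := by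
  have hkK : k < K := by
    by_contra hcon
    have := h.gap_eq he hℓ
    have := hK k (by omega)
    omega
  constructor
  · intro i hi
    have h1 := h.gap_add he hℓ i
    rw [hK i hi, if_neg (by omega), if_neg (by omega)] at h1
    omega
  -- A unit of weight `k + 1` turns into a unit of weight `k`, or disappears if `k = 0`.
  · have h1 : ∑ i ∈ Finset.range K, (i + 1) * (if i = k then 1 else 0) = k + 1 := by
      simp [hkK]
    have h2 : ∑ i ∈ Finset.range K, (i + 1) * (if i + 1 = k then 1 else 0) = k := by
      rcases k with _ | k
      · simp
      · simp [show k < K by omega]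
    have h3 : height e K A + ∑ i ∈ Finset.range K, (i + 1) * (if i + 1 = k then 1 else 0) =
        height e K B + ∑ i ∈ Finset.range K, (i + 1) * (if i = k then 1 else 0) := by
      unfold height
      rw [← Finset.sum_add_distrib, ← Finset.sum_add_distrib]
      refine Finset.sum_congr rfl fun i _ => ?_
      rw [← mul_add, ← mul_add, h.gap_add he hℓ i]
    omega

theorem exists_gap_bound (he : 0 < e) (hℓ : 0 < ℓ) (A : Abacus ℓ) :
    ∃ K, ∀ i, K ≤ i → gap e i A = 0 := by
  obtain ⟨K, hK⟩ := exists_not_loose he hℓ A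
  exact ⟨K, fun i hi => (gap_eq_zero_iff he hℓ).2 (hK i hi)⟩

theorem exists_packed (he : 0 < e) (hℓ : 0 < ℓ) (A : Abacus ℓ) :
    ∃ A₀, Packed e A₀ ∧ Relation.ReflTransGen (Descends e) A A₀ := by
  obtain ⟨K, hK⟩ := exists_gap_bound he hℓ A
  induction hn : height e K A using Nat.strong_induction_on generalizing A with
  | _ n ih =>
    by_cases hA : Packed e A
    · exact ⟨A, hA, .refl⟩
    · unfold Packed at hA
      push Not at hA
      obtain ⟨k, hk⟩ := hA
      obtain ⟨B, hB⟩ := (loose_iff_gap he hℓ).2 (Nat.pos_of_ne_zero hk)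
      obtain ⟨h1, h2⟩ := hB.gap_bound he hℓ hK
      obtain ⟨A₀, h3, h4⟩ := ih (height e K B) (by omega) B h1 rfl
      exact ⟨A₀, h3, .head ⟨k, hB⟩ h4⟩

/-- An abacus is determined by its gaps and by the packed abacus below it. -/
theorem eq_of_gap_eq (he : 0 < e) (hℓ : 0 < ℓ) {A B A₀ : Abacus ℓ} (hg : ∀ i, gap e i A = gap e i B)
    (h₀ : Packed e A₀) (hA : Relation.ReflTransGen (Descends e) A A₀)
    (hB : Relation.ReflTransGen (Descends e) B A₀) : A = B := by
  obtain ⟨K, hK⟩ := exists_gap_bound he hℓ A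
  induction hn : height e K A using Nat.strong_induction_on generalizing A B with
  | _ n ih =>
    by_cases hp : Packed e A
    · have hp' : Packed e B := fun k => (hg k).symm.trans (hp k)
      rw [← hp.eq_of_descends he hℓ hA, hp'.eq_of_descends he hℓ hB]
    · unfold Packed at hp
      push Not at hp
      obtain ⟨k, hk⟩ := hp
      obtain ⟨A', hA'⟩ := (loose_iff_gap he hℓ).2 (Nat.pos_of_ne_zero hk)
      obtain ⟨B', hB'⟩ := (loose_iff_gap he hℓ).2 (Nat.pos_of_ne_zero (hg k ▸ hk))
      obtain ⟨h1, h2⟩ := hA'.gap_bound he hℓ hK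
      -- The packed abacus below `C'` is also below `C`, hence equals `A₀`.
      have down : ∀ C C' : Abacus ℓ, TravelsUpstream e k C C' →
          Relation.ReflTransGen (Descends e) C A₀ → Relation.ReflTransGen (Descends e) C' A₀ := by
        intro C C' hC hC₀
        obtain ⟨C₀, h3, h4⟩ := exists_packed he hℓ C'
        rwa [← h3.unique he hℓ h₀ (.head ⟨k, hC⟩ h4) hC₀]
      have h5 := ih (height e K A') (by omega) (A := A') (B := B') (fun i => by
        have a1 := hA'.gap_add he hℓ i
        have a2 := hB'.gap_add he hℓ i
        have a3 := hg i
        omega) (down A A' hA' hA) (down B B' hB' hB) h1 rfl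
      subst h5
      exact (hA'.addsGoodStrip he hℓ).unique he hℓ (hB'.addsGoodStrip he hℓ)

end SlInfty

namespace SlInfty
variable {e ℓ : ℕ}

/-! ### Row lengths of Young diagrams -/

theorem ext_rowLen {μ ν : YoungDiagram} (h : ∀ i, μ.rowLen i = ν.rowLen i) : μ = ν := by
  apply YoungDiagram.ext
  ext ⟨i, j⟩
  rw [YoungDiagram.mem_cells, YoungDiagram.mem_cells, YoungDiagram.mem_iff_lt_rowLen,
    YoungDiagram.mem_iff_lt_rowLen, h]

theorem rowLen_bot (i : ℕ) : (⊥ : YoungDiagram).rowLen i = 0 := by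
  by_contra hne
  exact YoungDiagram.notMem_bot (i, 0)
    (YoungDiagram.mem_iff_lt_rowLen.2 (Nat.pos_of_ne_zero hne))

theorem rowLen_pos_iff {μ : YoungDiagram} {i : ℕ} : 0 < μ.rowLen i ↔ i < μ.colLen 0 := by
  rw [← YoungDiagram.mem_iff_lt_rowLen, YoungDiagram.mem_iff_lt_colLen]

theorem rowLen_eq_zero {μ : YoungDiagram} {i : ℕ} (h : μ.colLen 0 ≤ i) : μ.rowLen i = 0 := by
  by_contra hne
  have := rowLen_pos_iff.1 (Nat.pos_of_ne_zero hne)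
  omega

theorem card_eq_sum_rowLen (μ : YoungDiagram) {N : ℕ} (hN : μ.colLen 0 ≤ N) :
    μ.card = ∑ i ∈ Finset.range N, μ.rowLen i := by
  have h : Set.MapsTo Prod.fst (μ.cells : Set (ℕ × ℕ)) (Finset.range N) := by
    rintro ⟨i, j⟩ hij
    have h1 : (i, 0) ∈ μ := μ.up_left_mem le_rfl (Nat.zero_le j) ((YoungDiagram.mem_cells _).1 hij)
    have := YoungDiagram.mem_iff_lt_colLen.1 h1
    simpa using by omega
  rw [YoungDiagram.card, Finset.card_eq_sum_card_fiberwise h]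
  exact Finset.sum_congr rfl fun i _ => (YoungDiagram.rowLen_eq_card μ).symm

theorem rowLen_eq_of_diff {μ ν : YoungDiagram}
    (h : ∀ i, μ.rowLen i + ν.rowLen (i + 1) = ν.rowLen i + μ.rowLen (i + 1)) : μ = ν := by
  have key : ∀ n i, μ.rowLen (i + n) = ν.rowLen (i + n) → μ.rowLen i = ν.rowLen i := by
    intro n
    induction n with
    | zero => intro i; exact id
    | succ n ih =>
      intro i h1
      have h2 := ih (i + 1) (by rw [add_right_comm]; exact h1)
      have := h i
      omega
  refine ext_rowLen fun i => key (μ.colLen 0 + ν.colLen 0) i ?_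
  rw [rowLen_eq_zero (by omega), rowLen_eq_zero (by omega)]

/-- The partition with given differences of consecutive parts. -/
theorem exists_rowLen_eq (a : ℕ → ℕ) (r : ℕ) (h0 : ∀ k, r ≤ k → a k = 0)
    (h1 : 0 < r → a (r - 1) ≠ 0) :
    ∃ θ : YoungDiagram, θ.rowLens = (List.range r).map (fun k => ∑ m ∈ Finset.Ico k r, a m) ∧
      ∀ k, θ.rowLen k = a k + θ.rowLen (k + 1) := by
  have hs : ∀ k, k < r → ∑ m ∈ Finset.Ico k r, a m = a k + ∑ m ∈ Finset.Ico (k + 1) r, a m :=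
    fun k hk => Finset.sum_eq_sum_Ico_succ_bot hk a
  have hanti : Antitone fun k => ∑ m ∈ Finset.Ico k r, a m := fun i j hij =>
    Finset.sum_le_sum_of_subset (Finset.Ico_subset_Ico_left hij)
  have hsort : ((List.range r).map (fun k => ∑ m ∈ Finset.Ico k r, a m)).SortedGE :=
    (List.Pairwise.map (S := fun a b : ℕ => a ≥ b) _ (fun _ _ h => hanti h)
      List.pairwise_le_range).sortedGE
  have hpos : ∀ x ∈ (List.range r).map (fun k => ∑ m ∈ Finset.Ico k r, a m), 0 < x := by
    simp only [List.mem_map, List.mem_range]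
    rintro x ⟨k, hk, rfl⟩
    have h2 := Finset.single_le_sum (f := a) (fun i _ => Nat.zero_le _)
      (Finset.mem_Ico.2 ⟨show k ≤ r - 1 by omega, show r - 1 < r by omega⟩)
    have := h1 (by omega)
    omega
  refine ⟨YoungDiagram.ofRowLens _ hsort, YoungDiagram.rowLens_ofRowLens_eq_self hpos, ?_⟩
  set θ := YoungDiagram.ofRowLens _ hsort with hθ
  have hl : θ.rowLens = (List.range r).map (fun k => ∑ m ∈ Finset.Ico k r, a m) :=
    YoungDiagram.rowLens_ofRowLens_eq_self hpos
  have hc : θ.colLen 0 = r := by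
    rw [← YoungDiagram.length_rowLens, hl, List.length_map, List.length_range]
  have hrow : ∀ k, θ.rowLen k = ∑ m ∈ Finset.Ico k r, a m := by
    intro k
    rcases lt_or_ge k r with hk | hk
    · rw [← YoungDiagram.get_rowLens (h := by rw [YoungDiagram.length_rowLens, hc]; exact hk)]
      simp only [hl, List.getElem_map, List.getElem_range]
    · rw [rowLen_eq_zero (by omega), Finset.Ico_eq_empty (by omega), Finset.sum_empty]
  intro k
  rw [hrow, hrow]
  rcases lt_or_ge k r with hk | hk
  · exact hs k hk
  · rw [h0 k hk, Finset.Ico_eq_empty (by omega), Finset.Ico_eq_empty (by omega)]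
    simp

/-! ### The operators `b̃_σ` -/

/-- Each shift of the fore period with index `k` moves one unit from `gap (k - 1)` to `gap k`, so
`n` shifts need `n` units there. -/
theorem exists_steps_addsGoodStrip (he : 0 < e) (hℓ : 0 < ℓ) {k n : ℕ} {A : Abacus ℓ}
    (hn : ∀ i, i + 1 = k → n ≤ gap e i A) :
    ∃ B, Steps (AddsGoodStrip e k) n A B ∧ Relation.ReflTransGen (Descends e) B A ∧
      ∀ i, gap e i B + (if i + 1 = k then n else 0) = gap e i A + (if i = k then n else 0) := by
  induction n generalizing A with
  | zero => exact ⟨A, rfl, .refl, fun i => by simp⟩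
  | succ n ih =>
    obtain ⟨C, hC⟩ := exists_travelsUpstream he hℓ (A := A) (k := k)
      (fun i hi => (loose_iff_gap he hℓ).2 (by have := hn i hi; omega))
    have h1 := hC.gap_add he hℓ
    obtain ⟨B, h2, h3, h4⟩ := ih (A := C) (fun i hi => by
      have a1 := h1 i
      have a2 := hn i hi
      rw [if_pos hi, if_neg (by omega)] at a1
      omega)
    refine ⟨B, ⟨C, hC.addsGoodStrip he hℓ, h2⟩, h3.tail ⟨k, hC⟩, fun i => ?_⟩
    have a1 := h1 i
    have a2 := h4 i
    split_ifs at * <;> omega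

/-- The row just processed has received `σ (K - 1)` units and lost none, which leaves room for the
next `σ K ≤ σ (K - 1)` shifts. Since these shifts are deterministic, the given chain is the
constructed one. -/
theorem chain_gap (he : 0 < e) (hℓ : 0 < ℓ) {σ : ℕ → ℕ} (hσ : ∀ i, σ (i + 1) ≤ σ i)
    {c : ℕ → Abacus ℓ} {K : ℕ}
    (hc : ∀ k < K, Steps (AddsGoodStrip e k) (σ k) (c k) (c (k + 1))) :
    Relation.ReflTransGen (Descends e) (c K) (c 0) ∧
      ∀ i, gap e i (c K) + (if i + 1 < K then σ (i + 1) else 0) =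
        gap e i (c 0) + (if i < K then σ i else 0) := by
  induction K with
  | zero => exact ⟨.refl, fun i => by simp⟩
  | succ K ih =>
    obtain ⟨h1, h2⟩ := ih fun k hk => hc k (by omega)
    obtain ⟨B, h3, h4, h5⟩ := exists_steps_addsGoodStrip he hℓ (k := K) (n := σ K) (A := c K) (by
      rintro i rfl
      have a1 := h2 i
      have a2 := hσ i
      rw [if_neg (by omega), if_pos (by omega)] at a1
      omega)
    obtain rfl := (hc K (by omega)).unique (fun _ _ _ a b => a.unique he hℓ b) h3
    refine ⟨h4.trans h1, fun i => ?_⟩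
    have a1 := h2 i
    have a2 := h5 i
    rcases lt_trichotomy (i + 1) K with h | h | h
    · rw [if_pos (by omega), if_pos (by omega)] at a1 ⊢
      rw [if_neg (by omega), if_neg (by omega)] at a2
      omega
    · subst h
      rw [if_neg (by omega), if_pos (by omega)] at a1
      rw [if_pos (by omega), if_neg (by omega)] at a2
      rw [if_pos (by omega), if_pos (by omega)]
      omega
    · rw [if_neg (by omega), if_neg (by omega)] at a1
      rw [if_neg (by omega)] at a2 ⊢
      by_cases hi : i = K
      · subst hi
        rw [if_pos rfl] at a2
        rw [if_pos (by omega)]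
        omega
      · rw [if_neg hi] at a2
        rw [if_neg (by omega)]
        omega

theorem exists_chain (he : 0 < e) (hℓ : 0 < ℓ) {σ : ℕ → ℕ} (hσ : ∀ i, σ (i + 1) ≤ σ i)
    (A : Abacus ℓ) (K : ℕ) : ∃ c : ℕ → Abacus ℓ, c 0 = A ∧
      ∀ k < K, Steps (AddsGoodStrip e k) (σ k) (c k) (c (k + 1)) := by
  induction K with
  | zero => exact ⟨fun _ => A, rfl, fun k hk => by omega⟩
  | succ K ih =>
    obtain ⟨c, h0, hc⟩ := ih
    have h2 := (chain_gap he hℓ hσ hc).2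
    obtain ⟨B, h3, -⟩ := exists_steps_addsGoodStrip he hℓ (k := K) (n := σ K) (A := c K) (by
      rintro i rfl
      have a1 := h2 i
      have a2 := hσ i
      rw [if_neg (by omega), if_pos (by omega)] at a1
      omega)
    refine ⟨Function.update c (K + 1) B, by simp [h0], fun k hk => ?_⟩
    rw [Function.update_of_ne (by omega)]
    by_cases hkK : k = K
    · subst hkK
      rwa [Function.update_self]
    · rw [Function.update_of_ne (by omega)]
      exact hc k (by omega)

theorem Heisenberg.exists (he : 0 < e) (hℓ : 0 < ℓ) (σ : YoungDiagram) (A : Abacus ℓ) :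
    ∃ B, Heisenberg e σ A B := by
  obtain ⟨c, h0, hc⟩ := exists_chain he hℓ (σ := σ.rowLen)
    (fun i => σ.rowLen_anti _ _ (Nat.le_succ i)) A (σ.colLen 0)
  exact ⟨_, c, h0, rfl, hc⟩

theorem Heisenberg.unique (he : 0 < e) (hℓ : 0 < ℓ) {σ : YoungDiagram} {A B B' : Abacus ℓ}
    (h : Heisenberg e σ A B) (h' : Heisenberg e σ A B') : B = B' := by
  obtain ⟨c, h0, h1, hc⟩ := h
  obtain ⟨c', h0', h1', hc'⟩ := h'
  have key : ∀ k ≤ σ.colLen 0, c k = c' k := by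
    intro k
    induction k with
    | zero => intro _; rw [h0, h0']
    | succ k ih =>
      intro hk
      have h2 := hc k (by omega)
      rw [ih (by omega)] at h2
      exact h2.unique (fun _ _ _ a b => a.unique he hℓ b) (hc' k (by omega))
  rw [← h1, ← h1', key _ le_rfl]

theorem Heisenberg.descends (he : 0 < e) (hℓ : 0 < ℓ) {σ : YoungDiagram} {A B : Abacus ℓ}
    (h : Heisenberg e σ A B) : Relation.ReflTransGen (Descends e) B A := by
  obtain ⟨c, rfl, rfl, hc⟩ := h
  exact (chain_gap he hℓ (fun i => σ.rowLen_anti _ _ (Nat.le_succ i)) hc).1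

theorem Heisenberg.gap_add (he : 0 < e) (hℓ : 0 < ℓ) {σ : YoungDiagram} {A B : Abacus ℓ}
    (h : Heisenberg e σ A B) (i : ℕ) :
    gap e i B + σ.rowLen (i + 1) = gap e i A + σ.rowLen i := by
  obtain ⟨c, rfl, rfl, hc⟩ := h
  have := (chain_gap he hℓ (fun i => σ.rowLen_anti _ _ (Nat.le_succ i)) hc).2 i
  have h1 : (if i + 1 < σ.colLen 0 then σ.rowLen (i + 1) else 0) = σ.rowLen (i + 1) :=
    ite_eq_left_iff.2 fun h => (rowLen_eq_zero (by omega)).symm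
  have h2 : (if i < σ.colLen 0 then σ.rowLen i else 0) = σ.rowLen i :=
    ite_eq_left_iff.2 fun h => (rowLen_eq_zero (by omega)).symm
  rwa [h1, h2] at this

theorem exists_least_gap_bound (he : 0 < e) (hℓ : 0 < ℓ) (A : Abacus ℓ) :
    ∃ r, (∀ k, r ≤ k → gap e k A = 0) ∧ (0 < r → gap e (r - 1) A ≠ 0) := by
  classical
  have h := exists_gap_bound he hℓ A
  refine ⟨Nat.find h, Nat.find_spec h, fun hr h0 => ?_⟩
  refine Nat.find_min h (Nat.sub_one_lt hr.ne') fun k hk => ?_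
  rcases hk.eq_or_lt with rfl | hk
  · exact h0
  · exact Nat.find_spec h k (by omega)

/-- Every abacus is `b̃_θ` of the packed abacus below it. -/
theorem heisenberg_of_gap (he : 0 < e) (hℓ : 0 < ℓ) {A A₀ : Abacus ℓ} {θ : YoungDiagram}
    (h₀ : Packed e A₀) (hA : Relation.ReflTransGen (Descends e) A A₀)
    (hθ : ∀ k, θ.rowLen k = gap e k A + θ.rowLen (k + 1)) : Heisenberg e θ A₀ A := by
  obtain ⟨B, hB⟩ := Heisenberg.exists he hℓ θ A₀
  have : A = B := by
    refine eq_of_gap_eq he hℓ (fun i => ?_) h₀ hA (hB.descends he hℓ)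
    have := hB.gap_add he hℓ i
    have := h₀ i
    have := hθ i
    omega
  rwa [this]

theorem exists_heisenberg (he : 0 < e) (hℓ : 0 < ℓ) {A A₀ : Abacus ℓ}
    (h₀ : Packed e A₀) (hA : Relation.ReflTransGen (Descends e) A A₀) :
    ∃ θ, Heisenberg e θ A₀ A := by
  obtain ⟨r, h1, h2⟩ := exists_least_gap_bound he hℓ A
  obtain ⟨θ, -, hθ⟩ := exists_rowLen_eq (fun k => gap e k A) r h1 h2
  exact ⟨θ, heisenberg_of_gap he hℓ h₀ hA hθ⟩

/-- By `Heisenberg.gap_add`, vanishing gaps force `σ` to have constant row lengths, so `σ = ⊥`.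
Conversely, a highest weight vertex is `b̃_θ` of a packed abacus, with `θ = ⊥`. -/
theorem isHighestWeight_iff (he : 0 < e) (hℓ : 0 < ℓ) {A : Abacus ℓ} :
    IsHighestWeight e A ↔ Packed e A := by
  constructor
  · intro h
    obtain ⟨A₀, h₀, hA⟩ := exists_packed he hℓ A
    obtain ⟨θ, hθ⟩ := exists_heisenberg he hℓ h₀ hA
    obtain rfl := h A₀ θ hθ
    intro k
    have h1 := hθ.gap_add he hℓ k
    have h2 := h₀ k
    rw [rowLen_bot, rowLen_bot] at h1
    omega
  · intro h B σ hσ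
    refine rowLen_eq_of_diff fun i => ?_
    have h1 := hσ.gap_add he hℓ i
    have h2 := h i
    have h3 := σ.rowLen_anti i (i + 1) (Nat.le_succ i)
    rw [rowLen_bot, rowLen_bot]
    omega

/-! ### The arrows of the crystal -/

theorem rowArrow_iff (he : 0 < e) (hℓ : 0 < ℓ) {k : ℕ} {A B : Abacus ℓ} :
    RowArrow e k A B ↔ TravelsUpstream e k B A := by
  constructor
  · rintro ⟨A₀, θ, ρ, h₀, hbox, hθ, hρ⟩
    rw [isHighestWeight_iff he hℓ] at h₀
    have h1 : ∀ i, gap e i B + ρ.rowLen (i + 1) = ρ.rowLen i := fun i => by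
      rw [hρ.gap_add he hℓ, h₀ i, zero_add]
    have hL : Loose e k B := by
      rw [loose_iff_gap he hℓ]
      have a1 := h1 k
      have a2 := θ.rowLen_anti k (k + 1) (Nat.le_succ k)
      rw [hbox k, hbox (k + 1), if_pos rfl, if_neg (by omega)] at a1
      omega
    obtain ⟨A', hA'⟩ := hL
    obtain ⟨A₁, h₁, h2⟩ := exists_packed he hℓ A'
    obtain rfl := h₁.unique he hℓ h₀ (.head ⟨k, hA'⟩ h2) (hρ.descends he hℓ)
    have h3 : Heisenberg e θ A₁ A' := heisenberg_of_gap he hℓ h₀ h2 fun i => by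
      have a1 := h1 i
      have a2 := hA'.gap_add he hℓ i
      rw [hbox i, hbox (i + 1)] at a1
      split_ifs at * <;> omega
    rwa [hθ.unique he hℓ h3]
  · intro h
    obtain ⟨A₀, h₀, hA⟩ := exists_packed he hℓ A
    have hB : Relation.ReflTransGen (Descends e) B A₀ := .head ⟨k, h⟩ hA
    obtain ⟨θ, hθ⟩ := exists_heisenberg he hℓ h₀ hA
    obtain ⟨ρ, hρ⟩ := exists_heisenberg he hℓ h₀ hB
    refine ⟨A₀, θ, ρ, (isHighestWeight_iff he hℓ).2 h₀, ?_, hθ, hρ⟩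
    -- The gaps give the differences of consecutive parts; the parts are recovered upwards from a
    -- row where both vanish.
    have key : ∀ n i, ρ.rowLen (i + n) = θ.rowLen (i + n) → k < i + n →
        ρ.rowLen i = if i = k then θ.rowLen i + 1 else θ.rowLen i := by
      intro n
      induction n with
      | zero => intro i h1 h2; rw [if_neg (by omega)]; exact h1
      | succ n ih =>
        intro i h1 h2
        have h3 := ih (i + 1) (by rw [add_right_comm]; exact h1) (by omega)
        have a1 := hθ.gap_add he hℓ i
        have a2 := hρ.gap_add he hℓ i
        have a3 := h.gap_add he hℓ i
        have a4 := h₀ i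
        split_ifs at * <;> omega
    refine fun i => key (ρ.colLen 0 + θ.colLen 0 + k + 1) i ?_ (by omega)
    rw [rowLen_eq_zero (by omega), rowLen_eq_zero (by omega)]

theorem arrow_iff (he : 0 < e) (hℓ : 0 < ℓ) {A B : Abacus ℓ} : Arrow e A B ↔ Descends e B A :=
  exists_congr fun _ => rowArrow_iff he hℓ

theorem join_of_eqvGen (he : 0 < e) (hℓ : 0 < ℓ) {A B : Abacus ℓ}
    (h : Relation.EqvGen (Arrow e) A B) :
    Relation.Join (Relation.ReflTransGen (Descends e)) A B := by
  have heq := Relation.equivalence_join_reflTransGen (Descends.confluent (e := e) he hℓ)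
  induction h with
  | rel A B h => exact ⟨A, .refl, .single ((arrow_iff he hℓ).1 h)⟩
  | refl A => exact heq.refl A
  | symm A B _ ih => exact heq.symm ih
  | trans A B C _ _ ih ih' => exact heq.trans ih ih'

theorem eqvGen_of_descends (he : 0 < e) (hℓ : 0 < ℓ) {A B : Abacus ℓ}
    (h : Relation.ReflTransGen (Descends e) A B) : Relation.EqvGen (Arrow e) B A := by
  induction h with
  | refl => exact .refl _
  | tail _ h ih => exact .trans _ _ _ (.rel _ _ ((arrow_iff he hℓ).2 h)) ih

theorem exists_steps_arrow (he : 0 < e) (hℓ : 0 < ℓ) {A B : Abacus ℓ}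
    (h : Relation.ReflTransGen (Descends e) A B) : ∃ n, Steps (Arrow e) n B A := by
  induction h with
  | refl => exact ⟨0, rfl⟩
  | tail _ h ih =>
    obtain ⟨n, hn⟩ := ih
    exact ⟨n + 1, _, (arrow_iff he hℓ).2 h, hn⟩

theorem height_of_steps (he : 0 < e) (hℓ : 0 < ℓ) {A B : Abacus ℓ} {n K : ℕ}
    (h : Steps (Arrow e) n B A) (hK : ∀ i, K ≤ i → gap e i A = 0) :
    (∀ i, K ≤ i → gap e i B = 0) ∧ height e K A = height e K B + n := by
  induction n generalizing B with
  | zero =>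
    obtain rfl : B = A := h
    exact ⟨hK, rfl⟩
  | succ n ih =>
    obtain ⟨C, h1, h2⟩ := h
    obtain ⟨h3, h4⟩ := ih h2
    obtain ⟨k, hk⟩ := (arrow_iff he hℓ).1 h1
    obtain ⟨h5, h6⟩ := hk.gap_bound he hℓ h3
    exact ⟨h5, by omega⟩

/-- Summation by parts, the gaps being the differences of consecutive rows. -/
theorem card_eq_height {A : Abacus ℓ} {θ : YoungDiagram}
    (hθ : ∀ k, θ.rowLen k = gap e k A + θ.rowLen (k + 1)) {K : ℕ} (hK : θ.colLen 0 ≤ K) :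
    θ.card = height e K A := by
  have key : ∀ n, ∑ i ∈ Finset.range n, θ.rowLen i =
      ∑ i ∈ Finset.range n, (i + 1) * gap e i A + n * θ.rowLen n := by
    intro n
    induction n with
    | zero => simp
    | succ n ih =>
      rw [Finset.sum_range_succ, Finset.sum_range_succ, ih, hθ n]
      ring
  rw [card_eq_sum_rowLen θ hK, key K, rowLen_eq_zero hK, mul_zero, add_zero, height]

/-- Every arrow raises the height by one, and highest weight vertices have height zero, so all paths
to `A` have the same length. -/
theorem hasDepth_iff (he : 0 < e) (hℓ : 0 < ℓ) {A : Abacus ℓ} {θ : YoungDiagram}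
    (hθ : ∀ k, θ.rowLen k = gap e k A + θ.rowLen (k + 1)) {n : ℕ} :
    HasDepth e A n ↔ n = θ.card := by
  obtain ⟨K, hK⟩ := exists_gap_bound he hℓ A
  have key : ∀ m, HasDepth e A m → m = θ.card := by
    rintro m ⟨A₀, h₀, h⟩
    rw [isHighestWeight_iff he hℓ] at h₀
    rw [card_eq_height hθ (le_max_right K _),
      (height_of_steps he hℓ h fun i hi => hK i ((le_max_left _ _).trans hi)).2]
    simp [height, h₀ _]
  refine ⟨key n, ?_⟩
  rintro rfl
  obtain ⟨A₀, h₀, hA⟩ := exists_packed he hℓ A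
  obtain ⟨m, hm⟩ := exists_steps_arrow he hℓ hA
  have h : HasDepth e A m := ⟨A₀, (isHighestWeight_iff he hℓ).2 h₀, hm⟩
  rwa [← key m h]

end SlInfty

/-! ### The theorem -/

open SlInfty
theorem mainTheorem2 {e ℓ : ℕ} (he : 2 ≤ e) (hℓ : 2 ≤ ℓ) (A : Abacus ℓ) :
    ∃ (A₀ : Abacus ℓ) (θ : YoungDiagram) (α : ℕ → ℕ) (r : ℕ),
      -- `A₀` is the unique highest weight vertex in the connected component of `A`
      (∀ B : Abacus ℓ, IsHighestWeight e B ∧ Relation.EqvGen (Arrow e) B A ↔ B = A₀) ∧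
      -- `θ` is the unique partition with `A = b̃_θ A₀`
      (∀ σ : YoungDiagram, Heisenberg e σ A₀ A ↔ σ = θ) ∧
      -- `α k` is the number of successive times the aft period can travel upstream
      (∀ k, IsGreatest {q | ∃ B, Steps (TravelsUpstream e k) q A B} (α k)) ∧
      -- equivalently the number of times that the operator removing a box from the row can be applied
      (∀ k, IsGreatest {q | ∃ B, Steps (fun X Y => RowArrow e k Y X) q A B} (α k)) ∧
      -- `r` is the number of the last row with a nonzero `α`, or `0`
      (∀ k, r ≤ k → α k = 0) ∧ (0 < r → α (r - 1) ≠ 0) ∧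
      -- the position `θ = (δ_1, …, δ_r)`
      θ.rowLens = (List.range r).map (fun k => ∑ m ∈ Finset.Ico k r, α m) ∧
      -- the depth is `|θ|`
      (∀ n, HasDepth e A n ↔ n = θ.card) ∧
      ∀ (s : Fin ℓ → ℤ) (lam : Fin ℓ → YoungDiagram),
        abacusOf s lam = A → depth e s lam = θ.card := by
  replace he : 0 < e := by omega
  replace hℓ : 0 < ℓ := by omega
  obtain ⟨A₀, h₀, hA⟩ := exists_packed he hℓ A
  obtain ⟨r, h1, h2⟩ := exists_least_gap_bound he hℓ A
  obtain ⟨θ, hl, hθ⟩ := exists_rowLen_eq (fun k => gap e k A) r h1 h2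
  refine ⟨A₀, θ, fun k => gap e k A, r, fun B => ⟨fun ⟨hB, h⟩ => ?_, ?_⟩, fun σ => ⟨fun h => ?_, ?_⟩,
    fun k => isGreatest_gap he hℓ k A, fun k => ?_, h1, h2, hl, fun n => hasDepth_iff he hℓ hθ,
    fun s lam h => ?_⟩
  · rw [isHighestWeight_iff he hℓ] at hB
    obtain ⟨C, h3, h4⟩ := join_of_eqvGen he hℓ h
    obtain rfl := hB.eq_of_descends he hℓ h3
    exact hB.unique he hℓ h₀ h4 hA
  · rintro rfl
    exact ⟨(isHighestWeight_iff he hℓ).2 h₀, eqvGen_of_descends he hℓ hA⟩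
  · refine rowLen_eq_of_diff fun i => ?_
    have a1 := h.gap_add he hℓ i
    have a2 := hθ i
    have a3 := h₀ i
    omega
  · rintro rfl
    exact heisenberg_of_gap he hℓ h₀ hA hθ
  · rw [show (fun X Y : Abacus ℓ => RowArrow e k Y X) = TravelsUpstream e k from
      funext fun _ => funext fun _ => propext (rowArrow_iff he hℓ)]
    exact isGreatest_gap he hℓ k A
  · have h3 : {n | HasDepth e A n} = {θ.card} := Set.ext fun n => hasDepth_iff he hℓ hθ
    rw [depth, h, h3, csInf_singleton]
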